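/- Let $\phi_0(x)=\sqrt2\,\tanh(x)/\sqrt{3-\tanh^2(x)}$ be the black soliton and $\eta_0=1-\phi_0^4$. Let $\mathcal H$ be the space of continuous $f:\mathbb R\to\mathbb C$ whose weak derivative $f'$ is in $L^2(\mathbb R)$ and for which $\eta_0^{1/2}f\in L^2(\mathbb R)$, with the norm $\|f\|_{\mathcal H_0}=\big(\int_{\mathbb R}|f'|^2+\eta_0|f|^2\,dx\big)^{1/2}$, and let $\mathcal Z=\{u\in\mathcal H:\ 1-|u|^4\in L^2(\mathbb R)\}$. For $u\in\mathcal Z$ let $$E_2[u]=\int_{\mathbb R}\Big(|u'|^2+\tfrac13(1-|u|^2)^2(2+|u|^2)\Big)\,dx .$$ There is a universal constant $\Lambda_0>0$ such that the following holds. Let $\mathfrak z=\mathfrak z_1+i\mathfrak z_2\in\mathcal H$ ($\mathfrak z_1,\mathfrak z_2$ real-valued) be such that $\phi_0+\mathfrak z\in\mathcal Z$ and $$\int_{\mathbb R}\operatorname{Re}(\eta_0\bar{\mathfrak z})\,dx=0,\qquad \int_{\mathbb R}\operatorname{Re}(i\eta_0\bar{\mathfrak z})\,dx=0,\qquad \int_{\mathbb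 R}\operatorname{Re}(i\phi_0\eta_0\bar{\mathfrak z})\,dx=0,$$ and set $\rho_0=2\operatorname{Re}(\phi_0\bar{\mathfrak z})+|\mathfrak z|^2$. Then $E_2[\phi_0]$ and $E_2[\phi_0+\mathfrak z]$ are finite, $\phi_0^3\rho_0$ and $\mathfrak z_2\rho_0$ belong to $L^2(\mathbb R)$, and $$E_2[\phi_0+\mathfrak z]-E_2[\phi_0]\ \ge\ \Lambda_0\Big(\|\mathfrak z\|_{\mathcal H_0}^2+\|\phi_0^3\rho_0\|_{L^2}^2+\|\mathfrak z_2\rho_0\|_{L^2}^2\Big)-\frac1{\Lambda_0}\|\mathfrak z\|_{\mathcal H_0}^3 .$$ -/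

import Mathlib

open MeasureTheory
open scoped ContDiff ComplexConjugate

namespace QuinticGP

/-- `g` is a weak (distributional) derivative on `ℝ` of `f`: both are locally integrable and
`∫ ψ' f = - ∫ ψ g` for every smooth compactly supported real test function `ψ`. -/
structure HasWeakDeriv (f g : ℝ → ℂ) : Prop where
  locallyIntegrable_fun : LocallyIntegrable f volume
  locallyIntegrable_deriv : LocallyIntegrable g volume
  integral_eq : ∀ ψ : ℝ → ℝ, ContDiff ℝ ∞ ψ → HasCompactSupport ψ →
    ∫ x, deriv ψ x • f x = -∫ x, ψ x • g x

/-- Weak derivatives are unique almost everywhere. -/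
theorem HasWeakDeriv.ae_eq {f g h : ℝ → ℂ} (hg : HasWeakDeriv f g) (hh : HasWeakDeriv f h) :
    g =ᵐ[volume] h := by
  refine ae_eq_of_integral_contDiff_smul_eq hg.locallyIntegrable_deriv
    hh.locallyIntegrable_deriv fun ψ hψ hψc => ?_
  have h1 := hg.integral_eq ψ hψ hψc
  have h2 := hh.integral_eq ψ hψ hψc
  exact neg_injective (h1.symm.trans h2)

open Classical in
/-- The weak derivative `f'` of `f` (determined up to a null set when it exists; the constant
`0` when there is none, a case that never occurs for elements of the spaces below). -/
noncomputable def weakDeriv (f : ℝ → ℂ) : ℝ → ℂ :=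
  if h : ∃ g, HasWeakDeriv f g then h.choose else 0

theorem hasWeakDeriv_weakDeriv {f : ℝ → ℂ} (h : ∃ g, HasWeakDeriv f g) :
    HasWeakDeriv f (weakDeriv f) := by
  rw [weakDeriv, dif_pos h]
  exact h.choose_spec

theorem HasWeakDeriv.weakDeriv_ae_eq {f g : ℝ → ℂ} (h : HasWeakDeriv f g) :
    weakDeriv f =ᵐ[volume] g :=
  (hasWeakDeriv_weakDeriv ⟨g, h⟩).ae_eq h

/-- The black soliton `φ₀(x) = √2 tanh x / √(3 - tanh² x)`. -/
noncomputable def phi0 (x : ℝ) : ℝ :=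
  √2 * Real.tanh x / √(3 - Real.tanh x ^ 2)

/-- The weight `η₀ = 1 - φ₀⁴`. -/
noncomputable def eta0 (x : ℝ) : ℝ :=
  1 - phi0 x ^ 4

/-- The weighted Sobolev space `ℋ = ℋ₀` of continuous `f : ℝ → ℂ` with `f' ∈ L²` and
`η₀^{1/2} f ∈ L²`. -/
structure MemH (f : ℝ → ℂ) : Prop where
  continuous : Continuous f
  exists_hasWeakDeriv : ∃ g, HasWeakDeriv f g
  memLp_weakDeriv : MemLp (weakDeriv f) 2 volume
  memLp_weight : MemLp (fun x => √(eta0 x) • f x) 2 volume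

/-- The norm `‖f‖_{ℋ₀} = (∫ |f'|² + η₀ |f|²)^{1/2}`. -/
noncomputable def normH0 (f : ℝ → ℂ) : ℝ :=
  √(∫ x, (‖weakDeriv f x‖ ^ 2 + eta0 x * ‖f x‖ ^ 2))

/-- The subset `𝒵` of those `u ∈ ℋ` for which `1 - |u|⁴ ∈ L²`. -/
structure MemZ (u : ℝ → ℂ) : Prop where
  memH : MemH u
  memLp_one_sub : MemLp (fun x => 1 - ‖u x‖ ^ 4) 2 volume

/-- The `L²` norm `(∫ f²)^{1/2}` of a real function. -/
noncomputable def normL2 (f : ℝ → ℝ) : ℝ :=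
  √(∫ x, f x ^ 2)

/-- The density `|u'|² + (1/3) (1 - |u|²)² (2 + |u|²)` of the Ginzburg-Landau energy. -/
noncomputable def energyDensity (u : ℝ → ℂ) (x : ℝ) : ℝ :=
  ‖weakDeriv u x‖ ^ 2 + 1 / 3 * (1 - ‖u x‖ ^ 2) ^ 2 * (2 + ‖u x‖ ^ 2)

/-- The Ginzburg-Landau energy `E₂`. -/
noncomputable def E2 (u : ℝ → ℂ) : ℝ :=
  ∫ x, energyDensity u x

/-- The real pairing `⟨a, b⟩_ℂ = Re (a b̄)` of complex numbers. -/
noncomputable def pairing (a b : ℂ) : ℝ :=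
  (a * conj b).re

/-- `ρ₀ = 2 Re (φ₀ z̄) + |z|²`. -/
noncomputable def rho0 (z : ℝ → ℂ) (x : ℝ) : ℝ :=
  2 * ((phi0 x : ℂ) * conj (z x)).re + ‖z x‖ ^ 2

end QuinticGP

/-! Write `V(S) = (1 - S)² (2 + S) / 3`, so `V'(S) = -(1 - S²)`, `V'' = 2S`, `V''' = 2`. Since `|φ₀
+ z|² = φ₀² + ρ₀`, Taylor expansion in `ρ₀` is exact: the potential changes by `-η₀ ρ₀ + φ₀² ρ₀² +
ρ₀³/3`. The soliton solves `φ₀'' = -η₀ φ₀`, which kills the terms linear in `z`. With `Q(f) = ∫ f'²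
- η₀ f²` the energy difference is therefore exactly `Q(z₁) + Q(z₂) + ∫ excess`, where `excess = ρ₀²
(2 φ₀² + |φ₀ + z|²) / 3 ≥ 0` (`MemH.energy_sub`).

The form `Q` is governed by the weighted eigenvalue problem `-f'' = λ η₀ f`. The constant `1` has `λ
= 0` and `φ₀` has `λ = 1`; orthogonally to both, `∫ f'² ≥ (6/5) ∫ η₀ f²`
(`MemHReal.rayleigh_of_orthogonal`). To see this, add a combination of `1` and `φ₀` so that the
function vanishes at two symmetric nodes. For functions with these zeros the bound follows from a
Riccati comparison on each of the three intervals cut out by the nodes (`riccati_bound`).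

The three orthogonality conditions make `Q(z₂)` coercive, but `z₁` is orthogonal only to `1`, and
`Q` vanishes on `φ₀`. The missing direction is recovered from the excess: `φ₀² ρ₀²` is `4 φ₀⁴ z₁²`
up to cubic terms, and on `[0, 1]` this controls the `φ₀` component of `z₁` (`exists_coercive`).
Restricting to a bounded interval matters because the norm bounds `sup |z₁|` there
(`exists_sup_bound`), so the error is at most a constant times `‖z‖³`. The rest of the excess
supplies the two `ρ₀` norms (`MemH.le_integral_excess`). -/

namespace QuinticGP

open Set Filter Topology

/-! ### Primitives, weak derivatives and integration by parts -/

/-- `g` is locally integrable and `f` is a primitive of `g` on the whole line. -/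
structure IsPrimitive (f g : ℝ → ℝ) : Prop where
  intervalIntegrable : ∀ a b, IntervalIntegrable g volume a b
  integral_eq_sub : ∀ a b, ∫ x in a..b, g x = f b - f a

namespace IsPrimitive

variable {f g f₁ g₁ f₂ g₂ : ℝ → ℝ}

theorem eq_add_integral (h : IsPrimitive f g) (a : ℝ) : f = fun x => f a + ∫ t in a..x, g t := by
  funext x
  rw [h.integral_eq_sub]
  ring

theorem absolutelyContinuous (h : IsPrimitive f g) (a b : ℝ) :
    AbsolutelyContinuousOnInterval f a b := by
  rw [h.eq_add_integral a]
  have h1 : AbsolutelyContinuousOnInterval (fun _ : ℝ => f a) a b :=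
    contDiff_const.contDiffOn.absolutelyContinuousOnInterval
  exact h1.add ((h.intervalIntegrable a b).absolutelyContinuousOnInterval_intervalIntegral
    left_mem_uIcc)

theorem continuous (h : IsPrimitive f g) : Continuous f := by
  rw [h.eq_add_integral 0]
  exact continuous_const.add (intervalIntegral.continuous_primitive h.intervalIntegrable 0)

theorem ae_hasDerivAt (h : IsPrimitive f g) (a b : ℝ) :
    ∀ᵐ x, x ∈ uIcc a b → HasDerivAt f (g x) x := by
  filter_upwards [(h.intervalIntegrable a b).ae_hasDerivAt_integral] with x hx hxm
  have h1 := hx hxm a left_mem_uIcc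
  rw [h.eq_add_integral a]
  exact h1.const_add _

theorem of_hasDerivAt (h : ∀ x, HasDerivAt f (g x) x) (hg : Continuous g) : IsPrimitive f g where
  intervalIntegrable a b := hg.intervalIntegrable a b
  integral_eq_sub a b :=
    intervalIntegral.integral_eq_sub_of_hasDerivAt (fun x _ => h x) (hg.intervalIntegrable a b)

theorem const (c : ℝ) : IsPrimitive (fun _ => c) (fun _ => 0) :=
  of_hasDerivAt (fun x => hasDerivAt_const x c) continuous_const

theorem add (h₁ : IsPrimitive f₁ g₁) (h₂ : IsPrimitive f₂ g₂) :
    IsPrimitive (fun x => f₁ x + f₂ x) (fun x => g₁ x + g₂ x) where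
  intervalIntegrable a b := (h₁.intervalIntegrable a b).add (h₂.intervalIntegrable a b)
  integral_eq_sub a b := by
    rw [intervalIntegral.integral_add (h₁.intervalIntegrable a b) (h₂.intervalIntegrable a b),
      h₁.integral_eq_sub, h₂.integral_eq_sub]
    ring

theorem const_mul (h : IsPrimitive f g) (c : ℝ) :
    IsPrimitive (fun x => c * f x) (fun x => c * g x) where
  intervalIntegrable a b := (h.intervalIntegrable a b).const_mul c
  integral_eq_sub a b := by
    rw [intervalIntegral.integral_const_mul, h.integral_eq_sub]
    ring

theorem intervalIntegrable_mul (h₁ : IsPrimitive f₁ g₁) (h₂ : Continuous f₂) (a b : ℝ) :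
    IntervalIntegrable (fun x => g₁ x * f₂ x) volume a b :=
  (h₁.intervalIntegrable a b).mul_continuousOn h₂.continuousOn

/-- Primitives of locally integrable functions are absolutely continuous on bounded intervals, where
the product rule holds almost everywhere and integrates. -/
theorem mul (h₁ : IsPrimitive f₁ g₁) (h₂ : IsPrimitive f₂ g₂) :
    IsPrimitive (fun x => f₁ x * f₂ x) (fun x => g₁ x * f₂ x + f₁ x * g₂ x) where
  intervalIntegrable a b := by
    refine (h₁.intervalIntegrable_mul h₂.continuous a b).add ?_
    simpa only [mul_comm] using h₂.intervalIntegrable_mul h₁.continuous a b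
  integral_eq_sub a b := by
    rw [← AbsolutelyContinuousOnInterval.integral_deriv_mul_eq_sub
      (h₁.absolutelyContinuous a b) (h₂.absolutelyContinuous a b)]
    refine intervalIntegral.integral_congr_ae ?_
    filter_upwards [h₁.ae_hasDerivAt a b, h₂.ae_hasDerivAt a b] with x hx₁ hx₂ hx
    rw [(hx₁ (uIoc_subset_uIcc hx)).deriv, (hx₂ (uIoc_subset_uIcc hx)).deriv]

end IsPrimitive

theorem exists_eq_zero_of_le_abs {ψ : ℝ → ℝ} (hc : HasCompactSupport ψ) :
    ∃ R : ℝ, 0 < R ∧ ∀ x, R ≤ |x| → ψ x = 0 := by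
  obtain ⟨R, hR⟩ := hc.isCompact.isBounded.subset_closedBall 0
  refine ⟨max (R + 1) 1, by positivity, fun x hx => ?_⟩
  by_contra h
  have h1 := hR (subset_tsupport ψ h)
  rw [mem_closedBall_zero_iff, Real.norm_eq_abs] at h1
  have := le_max_left (R + 1) 1
  linarith

theorem integral_eq_intervalIntegral_of_eq_zero {ψ : ℝ → ℝ} {R : ℝ}
    (h : ∀ x, R ≤ |x| → ψ x = 0) : ∫ x, ψ x = ∫ x in (-R)..R, ψ x := by
  refine (intervalIntegral.integral_eq_integral_of_support_subset fun x hx => ?_).symm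
  have h1 : |x| < R := not_le.1 fun h' => hx (h x h')
  exact ⟨(abs_lt.1 h1).1, (abs_lt.1 h1).2.le⟩

/-- A primitive satisfies the integration by parts formula against test functions. -/
theorem IsPrimitive.integral_deriv_mul {f g : ℝ → ℝ} (h : IsPrimitive f g) {ψ : ℝ → ℝ}
    (hψ : ContDiff ℝ ∞ ψ) (hc : HasCompactSupport ψ) :
    ∫ x, deriv ψ x * f x = -∫ x, ψ x * g x := by
  obtain ⟨R, hR0, hR⟩ := exists_eq_zero_of_le_abs hc
  have hd : ∀ x, R < |x| → deriv ψ x = 0 := by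
    intro x hx
    have : ψ =ᶠ[𝓝 x] fun _ => 0 := by
      filter_upwards [continuous_abs.continuousAt.eventually (lt_mem_nhds hx)] with y hy
        using hR y hy.le
    rw [this.deriv_eq, deriv_const]
  -- The vanishing of `deriv ψ` is known only for `R < |x|`, hence the enlarged radius `R + 1`.
  have h1 : ∀ x, R + 1 ≤ |x| → deriv ψ x * f x = 0 := fun x hx => by
    rw [hd x (by linarith), zero_mul]
  have h2 : ∀ x, R + 1 ≤ |x| → ψ x * g x = 0 := fun x hx => by
    rw [hR x (by linarith), zero_mul]
  rw [integral_eq_intervalIntegral_of_eq_zero h1, integral_eq_intervalIntegral_of_eq_zero h2]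
  have hp : IsPrimitive ψ (deriv ψ) := IsPrimitive.of_hasDerivAt
    (fun x => (hψ.differentiable (by simp) x).hasDerivAt) (hψ.continuous_deriv (by simp))
  have h3 := (hp.mul h).integral_eq_sub (-(R + 1)) (R + 1)
  have hx1 : ψ (R + 1) = 0 := hR _ (by rw [abs_of_pos (by linarith)]; linarith)
  have hx2 : ψ (-(R + 1)) = 0 := hR _ (by rw [abs_neg, abs_of_pos (by linarith)]; linarith)
  rw [hx1, hx2, zero_mul, zero_mul, sub_zero, intervalIntegral.integral_add] at h3
  · linarith
  · exact hp.intervalIntegrable_mul h.continuous _ _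
  · simpa only [mul_comm] using h.intervalIntegrable_mul hp.continuous _ _

/-- A continuous function with vanishing weak derivative is constant. -/
theorem eq_of_forall_integral_deriv_mul_eq_zero {h : ℝ → ℝ} (hh : Continuous h)
    (H : ∀ ψ : ℝ → ℝ, ContDiff ℝ ∞ ψ → HasCompactSupport ψ → ∫ x, deriv ψ x * h x = 0)
    (a b : ℝ) : h a = h b := by
  -- Mollify: the derivative of each mollification of `h` is, up to sign, `h` tested against the
  -- derivative of a translated, reflected bump, hence zero. The mollifications are constant and
  -- converge pointwise to `h`.
  let φ : ℕ → ContDiffBump (0 : ℝ) := fun n =>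
    ⟨1 / (n + 1) / 2, 1 / (n + 1), by positivity, by
      have : (0 : ℝ) < 1 / (n + 1) := by positivity
      linarith⟩
  have hφ : Tendsto (fun n => (φ n).rOut) atTop (𝓝 0) := tendsto_one_div_add_atTop_nhds_zero_nat
  have hconst : ∀ n, convolution ((φ n).normed volume) h (ContinuousLinearMap.lsmul ℝ ℝ) volume a
      = convolution ((φ n).normed volume) h (ContinuousLinearMap.lsmul ℝ ℝ) volume b := by
    intro n
    have hd := fun x => HasCompactSupport.hasDerivAt_convolution_left
      (ContinuousLinearMap.lsmul ℝ ℝ) ((φ n).hasCompactSupport_normed (μ := volume))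
      ((φ n).contDiff_normed (n := 1)) (hh.locallyIntegrable (μ := volume)) x
    refine is_const_of_deriv_eq_zero (fun x => (hd x).differentiableAt) (fun x => ?_) a b
    rw [(hd x).deriv, convolution_eq_swap]
    have h1 := H (fun t => (φ n).normed volume (x - t))
      ((φ n).contDiff_normed.comp (contDiff_const.sub contDiff_id))
      ((φ n).hasCompactSupport_normed.comp_homeomorph (Homeomorph.subLeft x))
    simp_rw [deriv_comp_const_sub] at h1
    simp only [neg_mul, integral_neg, neg_eq_zero] at h1
    simpa using h1
  have ha := ContDiffBump.convolution_tendsto_right_of_continuous (μ := volume) hφ hh a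
  have hb := ContDiffBump.convolution_tendsto_right_of_continuous (μ := volume) hφ hh b
  simp_rw [hconst] at ha
  exact tendsto_nhds_unique ha hb

theorem intervalIntegrable_of_locallyIntegrable {E : Type*} [NormedAddCommGroup E] {g : ℝ → E}
    (hg : LocallyIntegrable g volume) (a b : ℝ) : IntervalIntegrable g volume a b :=
  (hg.integrableOn_isCompact isCompact_uIcc).intervalIntegrable

/-- A continuous function is a primitive of its weak derivative. -/
theorem isPrimitive_of_forall_integral {f g : ℝ → ℝ} (hf : Continuous f)
    (hg : LocallyIntegrable g volume)
    (H : ∀ ψ : ℝ → ℝ, ContDiff ℝ ∞ ψ → HasCompactSupport ψ →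
      ∫ x, deriv ψ x * f x = -∫ x, ψ x * g x) : IsPrimitive f g := by
  have hi := intervalIntegrable_of_locallyIntegrable hg
  have hF : IsPrimitive (fun x => ∫ t in (0 : ℝ)..x, g t) g :=
    ⟨hi, fun a b => (intervalIntegral.integral_interval_sub_left (hi 0 b) (hi 0 a)).symm⟩
  refine ⟨hi, fun a b => ?_⟩
  have hc := eq_of_forall_integral_deriv_mul_eq_zero (hf.sub hF.continuous)
    (fun ψ hψ hψc => ?_) a b
  · rw [hF.integral_eq_sub]
    simp only [Pi.sub_apply] at hc
    linarith
  · have hdc : Continuous (deriv ψ) := hψ.continuous_deriv (by simp)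
    simp only [Pi.sub_apply, mul_sub]
    rw [integral_sub, H ψ hψ hψc, hF.integral_deriv_mul hψ hψc, sub_self]
    · exact (hdc.mul hf).integrable_of_hasCompactSupport hψc.deriv.mul_right
    · exact (hdc.mul hF.continuous).integrable_of_hasCompactSupport hψc.deriv.mul_right

theorem HasWeakDeriv.integrable_smul {f g : ℝ → ℂ} (h : HasWeakDeriv f g) {ψ : ℝ → ℝ}
    (hψ : Continuous ψ) (hc : HasCompactSupport ψ) :
    Integrable (fun x => ψ x • f x) ∧ Integrable (fun x => ψ x • g x) :=
  ⟨h.locallyIntegrable_fun.integrable_smul_left_of_hasCompactSupport hψ hc,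
    h.locallyIntegrable_deriv.integrable_smul_left_of_hasCompactSupport hψ hc⟩

theorem HasWeakDeriv.isPrimitive_re {f g : ℝ → ℂ} (h : HasWeakDeriv f g) (hf : Continuous f) :
    IsPrimitive (fun x => (f x).re) (fun x => (g x).re) := by
  refine isPrimitive_of_forall_integral (Complex.continuous_re.comp hf)
    (fun x => (h.locallyIntegrable_deriv x).imp fun s hs => ⟨hs.1, hs.2.re⟩) fun ψ hψ hc => ?_
  have h1 := congrArg Complex.re (h.integral_eq ψ hψ hc)
  have i1 := (h.integrable_smul (hψ.continuous_deriv (by simp)) hc.deriv).1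
  have i2 := (h.integrable_smul hψ.continuous hc).2
  have e1 := integral_re i1
  have e2 := integral_re i2
  simp only [RCLike.re_to_complex, Complex.smul_re, smul_eq_mul] at e1 e2
  rw [e1, e2, h1, Complex.neg_re]

theorem HasWeakDeriv.isPrimitive_im {f g : ℝ → ℂ} (h : HasWeakDeriv f g) (hf : Continuous f) :
    IsPrimitive (fun x => (f x).im) (fun x => (g x).im) := by
  refine isPrimitive_of_forall_integral (Complex.continuous_im.comp hf)
    (fun x => (h.locallyIntegrable_deriv x).imp fun s hs => ⟨hs.1, hs.2.im⟩) fun ψ hψ hc => ?_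
  have h1 := congrArg Complex.im (h.integral_eq ψ hψ hc)
  have i1 := (h.integrable_smul (hψ.continuous_deriv (by simp)) hc.deriv).1
  have i2 := (h.integrable_smul hψ.continuous hc).2
  have e1 := integral_im i1
  have e2 := integral_im i2
  simp only [RCLike.im_to_complex, Complex.smul_im, smul_eq_mul] at e1 e2
  rw [e1, e2, h1, Complex.neg_im]

theorem HasWeakDeriv.add {f₁ g₁ f₂ g₂ : ℝ → ℂ} (h₁ : HasWeakDeriv f₁ g₁)
    (h₂ : HasWeakDeriv f₂ g₂) :
    HasWeakDeriv (fun x => f₁ x + f₂ x) (fun x => g₁ x + g₂ x) where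
  locallyIntegrable_fun := h₁.locallyIntegrable_fun.add h₂.locallyIntegrable_fun
  locallyIntegrable_deriv := h₁.locallyIntegrable_deriv.add h₂.locallyIntegrable_deriv
  integral_eq ψ hψ hc := by
    have hd : Continuous (deriv ψ) := hψ.continuous_deriv (by simp)
    simp only [smul_add]
    rw [integral_add (h₁.integrable_smul hd hc.deriv).1 (h₂.integrable_smul hd hc.deriv).1,
      integral_add (h₁.integrable_smul hψ.continuous hc).2 (h₂.integrable_smul hψ.continuous hc).2,
      h₁.integral_eq ψ hψ hc, h₂.integral_eq ψ hψ hc]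
    ring

/-- A continuously differentiable real function has its classical derivative as weak derivative. -/
theorem hasWeakDeriv_ofReal {f g : ℝ → ℝ} (h : ∀ x, HasDerivAt f (g x) x) (hg : Continuous g) :
    HasWeakDeriv (fun x => (f x : ℂ)) (fun x => (g x : ℂ)) where
  locallyIntegrable_fun := (Complex.continuous_ofReal.comp
    (IsPrimitive.of_hasDerivAt h hg).continuous).locallyIntegrable
  locallyIntegrable_deriv := (Complex.continuous_ofReal.comp hg).locallyIntegrable
  integral_eq ψ hψ hc := by
    have h1 := (IsPrimitive.of_hasDerivAt h hg).integral_deriv_mul hψ hc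
    simp only [Complex.real_smul, ← Complex.ofReal_mul]
    rw [integral_complex_ofReal, integral_complex_ofReal, h1, Complex.ofReal_neg]

/-! ### The black soliton, its equation and its decay -/

theorem hasDerivAt_tanh (x : ℝ) : HasDerivAt Real.tanh (1 - Real.tanh x ^ 2) x := by
  have hc := (Real.cosh_pos x).ne'
  have h := (Real.hasDerivAt_sinh x).div (Real.hasDerivAt_cosh x) hc
  have e : Real.tanh = Real.sinh / Real.cosh := by
    funext y
    exact Real.tanh_eq_sinh_div_cosh y
  rw [e]
  convert! h using 1
  simp only [Pi.div_apply]
  field_simp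

theorem strictMono_tanh : StrictMono Real.tanh :=
  strictMono_of_hasDerivAt_pos hasDerivAt_tanh fun x => by
    linarith [Real.tanh_sq_lt_one x]

theorem continuous_tanh : Continuous Real.tanh :=
  continuous_iff_continuousAt.2 fun x => (hasDerivAt_tanh x).continuousAt

/-- The left side is `1 / cosh² = 1 / (1 + sinh²)`, and `|sinh x| ≥ |x|`. Quadratic decay suffices
for all later integrability and boundary terms. -/
theorem one_sub_tanh_sq_le (x : ℝ) : 1 - Real.tanh x ^ 2 ≤ (1 + x ^ 2)⁻¹ := by
  have hc := Real.cosh_pos x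
  have hs : x ^ 2 ≤ Real.sinh x ^ 2 := by
    rw [sq_le_sq, Real.abs_sinh]
    exact Real.self_le_sinh_iff.2 (abs_nonneg x)
  have e : 1 - Real.tanh x ^ 2 = (Real.cosh x ^ 2)⁻¹ := by
    rw [Real.tanh_eq_sinh_div_cosh]
    have := Real.cosh_sq x
    field_simp
    linarith
  rw [e, Real.cosh_sq]
  exact inv_anti₀ (by positivity) (by linarith)

theorem three_sub_tanh_sq (x : ℝ) : 2 < 3 - Real.tanh x ^ 2 := by
  linarith [Real.tanh_sq_lt_one x]

theorem phi0_sq (x : ℝ) : phi0 x ^ 2 = 2 * Real.tanh x ^ 2 / (3 - Real.tanh x ^ 2) := by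
  have := three_sub_tanh_sq x
  rw [phi0, div_pow, mul_pow, Real.sq_sqrt (by norm_num), Real.sq_sqrt (by linarith)]

theorem eta0_eq (x : ℝ) : eta0 x =
    3 * (1 - Real.tanh x ^ 2) * (3 + Real.tanh x ^ 2) / (3 - Real.tanh x ^ 2) ^ 2 := by
  have := three_sub_tanh_sq x
  have h0 : 3 - Real.tanh x ^ 2 ≠ 0 := by linarith
  rw [eta0, show phi0 x ^ 4 = (phi0 x ^ 2) ^ 2 by ring, phi0_sq]
  field_simp
  ring

theorem phi0_sq_lt_one (x : ℝ) : phi0 x ^ 2 < 1 := by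
  have h := three_sub_tanh_sq x
  rw [phi0_sq, div_lt_one (by linarith)]
  linarith [Real.tanh_sq_lt_one x]

theorem eta0_pos (x : ℝ) : 0 < eta0 x := by
  have := phi0_sq_lt_one x
  rw [eta0]
  nlinarith [sq_nonneg (phi0 x)]

theorem eta0_le_one (x : ℝ) : eta0 x ≤ 1 := by
  rw [eta0]
  nlinarith [sq_nonneg (phi0 x ^ 2)]

theorem eta0_le (x : ℝ) : eta0 x ≤ 3 * (1 + x ^ 2)⁻¹ := by
  have h := three_sub_tanh_sq x
  have h1 := Real.tanh_sq_lt_one x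
  refine le_trans ?_ (mul_le_mul_of_nonneg_left (one_sub_tanh_sq_le x) (by norm_num))
  rw [eta0_eq, div_le_iff₀ (by positivity)]
  refine mul_le_mul_of_nonneg_left ?_ (by linarith)
  nlinarith [mul_nonneg (sub_nonneg.2 h1.le) (show 0 ≤ 6 - Real.tanh x ^ 2 by linarith)]

theorem one_sub_phi0_sq_le (x : ℝ) : 1 - phi0 x ^ 2 ≤ eta0 x := by
  have := phi0_sq_lt_one x
  rw [eta0]
  nlinarith [sq_nonneg (phi0 x)]

/-- The derivative of the black soliton. -/
noncomputable def dphi0 (x : ℝ) : ℝ :=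
  3 * √2 * (1 - Real.tanh x ^ 2) / ((3 - Real.tanh x ^ 2) * √(3 - Real.tanh x ^ 2))

theorem hasDerivAt_sqrt_three_sub (x : ℝ) : HasDerivAt (fun y => √(3 - Real.tanh y ^ 2))
    (-(Real.tanh x * (1 - Real.tanh x ^ 2)) / √(3 - Real.tanh x ^ 2)) x := by
  have h := three_sub_tanh_sq x
  have h1 := (((hasDerivAt_tanh x).fun_pow 2).const_sub 3).sqrt (by linarith)
  convert! h1 using 1
  have : √(3 - Real.tanh x ^ 2) ≠ 0 := (Real.sqrt_pos.2 (by linarith)).ne'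
  field_simp
  ring

theorem hasDerivAt_phi0 (x : ℝ) : HasDerivAt phi0 (dphi0 x) x := by
  have h := three_sub_tanh_sq x
  have hS : √(3 - Real.tanh x ^ 2) ≠ 0 := (Real.sqrt_pos.2 (by linarith)).ne'
  have h1 := ((hasDerivAt_tanh x).const_mul √2).fun_div (hasDerivAt_sqrt_three_sub x) hS
  convert! h1 using 1
  have e : 3 - Real.tanh x ^ 2 = √(3 - Real.tanh x ^ 2) ^ 2 := (Real.sq_sqrt (by linarith)).symm
  rw [dphi0]
  generalize √(3 - Real.tanh x ^ 2) = S at *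
  generalize Real.tanh x = t at *
  rw [e]
  field_simp
  linear_combination (1 - t ^ 2) * e

/-- The soliton equation `φ₀'' = -η₀ φ₀`: it removes the linear part of the energy and makes `φ₀` an
eigenfunction. -/
theorem hasDerivAt_dphi0 (x : ℝ) : HasDerivAt dphi0 (-(eta0 x * phi0 x)) x := by
  have h := three_sub_tanh_sq x
  have hS : √(3 - Real.tanh x ^ 2) ≠ 0 := (Real.sqrt_pos.2 (by linarith)).ne'
  have h2 : HasDerivAt (fun y => 3 - Real.tanh y ^ 2)
      (-(2 * Real.tanh x * (1 - Real.tanh x ^ 2))) x := by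
    have := ((hasDerivAt_tanh x).fun_pow 2).const_sub 3
    convert! this using 1
    ring
  have h3 : HasDerivAt (fun y => 1 - Real.tanh y ^ 2)
      (-(2 * Real.tanh x * (1 - Real.tanh x ^ 2))) x := by
    have := ((hasDerivAt_tanh x).fun_pow 2).const_sub 1
    convert! this using 1
    ring
  have h1 := (h3.const_mul (3 * √2)).fun_div (h2.fun_mul (hasDerivAt_sqrt_three_sub x))
    (mul_ne_zero (by linarith) hS)
  convert! h1 using 1
  have e : 3 - Real.tanh x ^ 2 = √(3 - Real.tanh x ^ 2) ^ 2 := (Real.sq_sqrt (by linarith)).symm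
  rw [eta0_eq, phi0]
  generalize √(3 - Real.tanh x ^ 2) = S at *
  generalize Real.tanh x = t at *
  have e' : t ^ 2 = 3 - S ^ 2 := by linarith
  rw [e', show (3 - (3 - S ^ 2)) = S ^ 2 by ring]
  field_simp
  ring

theorem continuous_phi0 : Continuous phi0 :=
  continuous_iff_continuousAt.2 fun x => (hasDerivAt_phi0 x).continuousAt

theorem continuous_dphi0 : Continuous dphi0 :=
  continuous_iff_continuousAt.2 fun x => (hasDerivAt_dphi0 x).continuousAt

theorem continuous_eta0 : Continuous eta0 :=
  continuous_const.sub (continuous_phi0.pow 4)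

theorem dphi0_nonneg (x : ℝ) : 0 ≤ dphi0 x := by
  have h := three_sub_tanh_sq x
  have := Real.tanh_sq_lt_one x
  rw [dphi0]
  have : 0 ≤ 1 - Real.tanh x ^ 2 := by linarith
  positivity

theorem dphi0_le (x : ℝ) : dphi0 x ≤ 3 * (1 + x ^ 2)⁻¹ := by
  have h := three_sub_tanh_sq x
  have h1 := Real.tanh_sq_lt_one x
  refine le_trans ?_ (mul_le_mul_of_nonneg_left (one_sub_tanh_sq_le x) (by norm_num))
  have hs : √2 ≤ √(3 - Real.tanh x ^ 2) := Real.sqrt_le_sqrt h.le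
  have h2 : 0 ≤ √2 := Real.sqrt_nonneg _
  rw [dphi0, div_le_iff₀ (by positivity)]
  have h3 : √2 ≤ (3 - Real.tanh x ^ 2) * √(3 - Real.tanh x ^ 2) := by nlinarith
  have h4 : 0 ≤ 3 * (1 - Real.tanh x ^ 2) := by linarith
  nlinarith [mul_le_mul_of_nonneg_left h3 h4]

theorem dphi0_le_three (x : ℝ) : dphi0 x ≤ 3 := by
  have h1 : (1 + x ^ 2)⁻¹ ≤ 1 := inv_le_one_of_one_le₀ (by nlinarith [sq_nonneg x])
  linarith [dphi0_le x]

theorem integrable_eta0 : Integrable eta0 :=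
  (integrable_inv_one_add_sq.const_mul 3).mono' continuous_eta0.aestronglyMeasurable
    (Eventually.of_forall fun x => by
      rw [Real.norm_eq_abs, abs_of_pos (eta0_pos x)]
      exact eta0_le x)

theorem memLp_two_of_integrable_sq {f : ℝ → ℝ} (hf : AEStronglyMeasurable f)
    (h : Integrable fun x => f x ^ 2) : MemLp f 2 volume :=
  (memLp_two_iff_integrable_sq hf).2 h

theorem memLp_dphi0 : MemLp dphi0 2 volume := by
  refine memLp_two_of_integrable_sq continuous_dphi0.aestronglyMeasurable
    ((integrable_inv_one_add_sq.const_mul 9).mono' (continuous_dphi0.pow 2).aestronglyMeasurable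
      (Eventually.of_forall fun x => ?_))
  rw [Real.norm_eq_abs, abs_of_nonneg (by positivity)]
  nlinarith [dphi0_nonneg x, dphi0_le x, dphi0_le_three x]

theorem memLp_sqrt_eta0 : MemLp (fun x => √(eta0 x)) 2 volume := by
  refine memLp_two_of_integrable_sq
    (Real.continuous_sqrt.comp continuous_eta0).aestronglyMeasurable ?_
  simpa only [Real.sq_sqrt (eta0_pos _).le] using integrable_eta0

theorem memLp_one_sub_phi0_sq : MemLp (fun x => 1 - phi0 x ^ 2) 2 volume := by
  have hc : Continuous fun x => 1 - phi0 x ^ 2 := continuous_const.sub (continuous_phi0.pow 2)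
  refine memLp_two_of_integrable_sq hc.aestronglyMeasurable
    (integrable_eta0.mono' (hc.pow 2).aestronglyMeasurable (Eventually.of_forall fun x => ?_))
  rw [Real.norm_eq_abs, abs_of_nonneg (by positivity)]
  have := phi0_sq_lt_one x
  nlinarith [sq_nonneg (phi0 x), one_sub_phi0_sq_le x]

/-! ### The weighted Sobolev space of real functions -/

/-- Real functions `f` of the weighted Sobolev space, with weak derivative `g`. -/
structure MemHReal (f g : ℝ → ℝ) : Prop where
  isPrimitive : IsPrimitive f g
  memLp_deriv : MemLp g 2 volume
  memLp_weight : MemLp (fun x => √(eta0 x) * f x) 2 volume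

namespace MemHReal

variable {f g f₁ g₁ f₂ g₂ : ℝ → ℝ}

theorem add (h₁ : MemHReal f₁ g₁) (h₂ : MemHReal f₂ g₂) :
    MemHReal (fun x => f₁ x + f₂ x) (fun x => g₁ x + g₂ x) where
  isPrimitive := h₁.isPrimitive.add h₂.isPrimitive
  memLp_deriv := h₁.memLp_deriv.add h₂.memLp_deriv
  memLp_weight := by
    simp only [mul_add]
    exact h₁.memLp_weight.add h₂.memLp_weight

theorem const_mul (h : MemHReal f g) (c : ℝ) :
    MemHReal (fun x => c * f x) (fun x => c * g x) where
  isPrimitive := h.isPrimitive.const_mul c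
  memLp_deriv := h.memLp_deriv.const_mul c
  memLp_weight := by
    simp only [mul_left_comm _ c]
    exact h.memLp_weight.const_mul c

theorem const (c : ℝ) : MemHReal (fun _ => c) (fun _ => 0) where
  isPrimitive := IsPrimitive.const c
  memLp_deriv := MemLp.zero'
  memLp_weight := by
    simp only [mul_comm _ c]
    exact memLp_sqrt_eta0.const_mul c

theorem integrable_deriv_mul (h₁ : MemHReal f₁ g₁) (h₂ : MemHReal f₂ g₂) :
    Integrable fun x => g₁ x * g₂ x :=
  h₁.memLp_deriv.integrable_mul h₂.memLp_deriv

theorem integrable_weight_mul (h₁ : MemHReal f₁ g₁) (h₂ : MemHReal f₂ g₂) :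
    Integrable fun x => eta0 x * (f₁ x * f₂ x) := by
  refine (h₁.memLp_weight.integrable_mul h₂.memLp_weight).congr (Eventually.of_forall fun x => ?_)
  simp only [Pi.mul_apply]
  nth_rewrite 3 [← Real.sq_sqrt (eta0_pos x).le]
  ring

theorem integrable_deriv_sq (h : MemHReal f g) : Integrable fun x => g x ^ 2 :=
  h.memLp_deriv.integrable_sq

theorem integrable_weight_sq (h : MemHReal f g) : Integrable fun x => eta0 x * f x ^ 2 := by
  simpa only [sq] using h.integrable_weight_mul h

theorem integrable_weight (h : MemHReal f g) : Integrable fun x => eta0 x * f x := by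
  simpa only [one_mul] using (const 1).integrable_weight_mul h

/-- Integrate `|g| ≤ (1 + g²) / 2`. This already gives linear growth; applying it to multiples of
`f` recovers the Cauchy–Schwarz form in `MemHReal.sq_sub_le`. -/
theorem abs_sub_le (h : MemHReal f g) (a b : ℝ) :
    |f b - f a| ≤ (|b - a| + ∫ x, g x ^ 2) / 2 := by
  have hi := h.isPrimitive.intervalIntegrable a b
  have hone : IntegrableOn (fun _ => (1 : ℝ)) (uIoc a b) := integrableOn_const (by simp)
  have hsq : IntegrableOn (fun x => g x ^ 2) (uIoc a b) := h.integrable_deriv_sq.integrableOn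
  rw [← h.isPrimitive.integral_eq_sub a b, ← Real.norm_eq_abs]
  refine intervalIntegral.norm_integral_le_integral_norm_uIoc.trans ?_
  have h1 : ∫ x in uIoc a b, ‖g x‖ ≤ ∫ x in uIoc a b, (1 + g x ^ 2) / 2 := by
    refine setIntegral_mono hi.def'.norm ?_ fun x => ?_
    · exact (hone.add hsq).div_const 2
    · rw [Real.norm_eq_abs]
      nlinarith [sq_nonneg (|g x| - 1), sq_abs (g x)]
  refine h1.trans ?_
  have h4 : ∫ x in uIoc a b, (1 + g x ^ 2) = (∫ x in uIoc a b, (1 : ℝ)) +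
      ∫ x in uIoc a b, g x ^ 2 := integral_add hone hsq
  rw [integral_div, h4]
  have h2 : ∫ x in uIoc a b, g x ^ 2 ≤ ∫ x, g x ^ 2 :=
    setIntegral_le_integral h.integrable_deriv_sq (Eventually.of_forall fun x => sq_nonneg _)
  have h3 : ∫ x in uIoc a b, (1 : ℝ) = |b - a| := by simp [Measure.real]
  linarith

/-- Elements of the space grow slower than `1 / φ₀'`. -/
theorem tendsto_dphi0_mul (h : MemHReal f g) {l : Filter ℝ}
    (hl : Tendsto (fun x : ℝ => |x|) l atTop) :
    Tendsto (fun x => dphi0 x * f x) l (𝓝 0) := by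
  set C : ℝ := |f 0| + ∫ x, g x ^ 2 with hC
  have hI : 0 ≤ ∫ x, g x ^ 2 := integral_nonneg fun x => sq_nonneg _
  have hC0 : 0 ≤ C := by positivity
  have hbound : ∀ x : ℝ, 1 ≤ |x| → ‖dphi0 x * f x‖ ≤ (3 * (C + 1)) * |x|⁻¹ := by
    intro x hx
    have h1 := h.abs_sub_le 0 x
    have h2 : |f x| ≤ |f x - f 0| + |f 0| := by
      have := abs_add_le (f x - f 0) (f 0)
      simpa using this
    rw [sub_zero] at h1
    have h3 : |f x| ≤ (C + 1) * |x| := by nlinarith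
    have h4 : dphi0 x ≤ 3 * (|x| ^ 2)⁻¹ := by
      refine (dphi0_le x).trans (mul_le_mul_of_nonneg_left ?_ (by norm_num))
      exact inv_anti₀ (by positivity) (by rw [sq_abs]; linarith)
    rw [norm_mul, Real.norm_eq_abs, Real.norm_eq_abs, abs_of_nonneg (dphi0_nonneg x)]
    calc dphi0 x * |f x| ≤ (3 * (|x| ^ 2)⁻¹) * ((C + 1) * |x|) := by
          gcongr
      _ = (3 * (C + 1)) * |x|⁻¹ := by
          have : |x| ≠ 0 := by positivity
          field_simp
  have hlim : Tendsto (fun x : ℝ => (3 * (C + 1)) * |x|⁻¹) l (𝓝 0) := by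
    simpa using (tendsto_inv_atTop_zero.comp hl).const_mul (3 * (C + 1))
  refine squeeze_zero_norm' ?_ hlim
  filter_upwards [hl.eventually_ge_atTop 1] with x hx using hbound x hx

end MemHReal

/-! ### The soliton as an eigenfunction -/

theorem memHReal_phi0 : MemHReal phi0 dphi0 where
  isPrimitive := IsPrimitive.of_hasDerivAt hasDerivAt_phi0 continuous_dphi0
  memLp_deriv := memLp_dphi0
  memLp_weight := by
    have hc : Continuous fun x => √(eta0 x) * phi0 x :=
      (Real.continuous_sqrt.comp continuous_eta0).mul continuous_phi0
    refine memLp_two_of_integrable_sq hc.aestronglyMeasurable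
      (integrable_eta0.mono' (hc.pow 2).aestronglyMeasurable (Eventually.of_forall fun x => ?_))
    rw [Real.norm_eq_abs, abs_of_nonneg (by positivity), mul_pow, Real.sq_sqrt (eta0_pos x).le]
    nlinarith [eta0_pos x, phi0_sq_lt_one x]

/-- `φ₀` is an eigenfunction of `-f'' = λ η₀ f` for `λ = 1`, in weak form. -/
theorem MemHReal.integral_dphi0_mul {f g : ℝ → ℝ} (h : MemHReal f g) :
    ∫ x, dphi0 x * g x = ∫ x, eta0 x * (phi0 x * f x) := by
  have hd : IsPrimitive dphi0 (fun x => -(eta0 x * phi0 x)) :=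
    IsPrimitive.of_hasDerivAt hasDerivAt_dphi0 (continuous_eta0.mul continuous_phi0).neg
  have hp := hd.mul h.isPrimitive
  have i1 := memHReal_phi0.integrable_deriv_mul h
  have i2 := memHReal_phi0.integrable_weight_mul h
  have i3 : Integrable fun x => -(eta0 x * phi0 x) * f x := by
    refine i2.neg.congr (Eventually.of_forall fun x => ?_)
    simp only [Pi.neg_apply]
    ring
  -- Integrate the derivative of `φ₀' f` over `[-R, R]` and let `R` tend to infinity; the boundary
  -- terms vanish because `φ₀'` decays quadratically and `f` grows at most linearly.
  have h1 := intervalIntegral_tendsto_integral (i3.add i1) tendsto_neg_atTop_atBot tendsto_id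
  simp only [Pi.add_apply, hp.integral_eq_sub, id] at h1
  have hT := h.tendsto_dphi0_mul tendsto_abs_atTop_atTop
  have hB := (h.tendsto_dphi0_mul tendsto_abs_atBot_atTop).comp tendsto_neg_atTop_atBot
  have h2 := tendsto_nhds_unique h1 (hT.sub hB)
  rw [integral_add i3 i1] at h2
  have h3 : ∫ x, -(eta0 x * phi0 x) * f x = -∫ x, eta0 x * (phi0 x * f x) := by
    rw [← integral_neg]
    congr 1
    funext x
    ring
  linarith

/-- The eigenfunction identity tested against the constant `1`, whose derivative vanishes. -/
theorem integral_eta0_mul_phi0 : ∫ x, eta0 x * phi0 x = 0 := by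
  have := (MemHReal.const 1).integral_dphi0_mul
  simpa using this.symm

theorem integral_dphi0_sq : ∫ x, dphi0 x ^ 2 = ∫ x, eta0 x * phi0 x ^ 2 := by
  simpa only [sq] using memHReal_phi0.integral_dphi0_mul

/-! ### Riccati comparison for functions with two nodes -/

/-- Riccati form of the lower bound for the Rayleigh quotient on an interval. -/
theorem riccati_bound {f g r r' q : ℝ → ℝ} {a b : ℝ} (hab : a ≤ b) (h : IsPrimitive f g)
    (hg : MemLp g 2 volume) (hq : Continuous q)
    (hr : ∀ x ∈ Icc a b, HasDerivAt r (r' x) x) (hr' : ContinuousOn r' (Icc a b))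
    (hle : ∀ x ∈ Icc a b, r' x + r x ^ 2 ≤ -q x) :
    r b * f b ^ 2 - r a * f a ^ 2 ≤ ∫ x in a..b, (g x ^ 2 - q x * f x ^ 2) := by
  -- The function `r` is controlled only on `[a, b]`. Extending `r'` continuously to the line gives
  -- a global primitive `R` that agrees with `r` there, so the product rule applies to `R f²`.
  set s : ℝ → ℝ := IccExtend hab ((Icc a b).domRestrict r') with hs
  have hsc : Continuous s := (continuousOn_iff_continuous_domRestrict.1 hr').Icc_extend'
  have hse : ∀ x ∈ Icc a b, s x = r' x := fun x hx => by
    rw [hs, IccExtend_of_mem hab _ hx, domRestrict_apply]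
  set R : ℝ → ℝ := fun x => r a + ∫ t in a..x, s t with hR
  have hRp : IsPrimitive R s := IsPrimitive.of_hasDerivAt
    (fun x => ((hsc.integral_hasStrictDerivAt a x).hasDerivAt).const_add _) hsc
  have hRr : ∀ x ∈ Icc a b, R x = r x := by
    intro x hx
    have hsub : uIcc a x ⊆ Icc a b := by
      rw [uIcc_of_le hx.1]
      exact Icc_subset_Icc_right hx.2
    have h1 : ∫ t in a..x, s t = ∫ t in a..x, r' t :=
      intervalIntegral.integral_congr fun t ht => hse t (hsub ht)
    rw [hR]
    simp only
    rw [h1, intervalIntegral.integral_eq_sub_of_hasDerivAt (fun t ht => hr t (hsub ht))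
      (hr'.mono hsub).intervalIntegrable]
    ring
  have hp := hRp.mul (h.mul h)
  have h1 := hp.integral_eq_sub a b
  rw [hRr a (left_mem_Icc.2 hab), hRr b (right_mem_Icc.2 hab)] at h1
  rw [sq (f b), sq (f a), ← h1]
  have hgsq : IntervalIntegrable (fun x => g x ^ 2) volume a b :=
    hg.integrable_sq.intervalIntegrable
  refine intervalIntegral.integral_mono_on hab (hp.intervalIntegrable a b)
    (hgsq.sub ((hq.mul (h.continuous.pow 2)).intervalIntegrable a b)) fun x hx => ?_
  rw [hse x hx, hRr x hx]
  have h2 := hle x hx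
  -- Complete the square: `g² - q f² - (r f²)' = (g - r f)² - (r' + r² + q) f² ≥ 0`.
  nlinarith [sq_nonneg (g x - r x * f x), mul_le_mul_of_nonneg_right h2 (sq_nonneg (f x))]

/-- A node with `tanh = 1/2`. -/
noncomputable def node : ℝ := Real.artanh (1 / 2)

theorem tanh_node : Real.tanh node = 1 / 2 := Real.tanh_artanh ⟨by norm_num, by norm_num⟩

theorem node_pos : 0 < node := Real.artanh_pos ⟨by norm_num, by norm_num⟩

theorem phi0_neg (x : ℝ) : phi0 (-x) = -phi0 x := by
  rw [phi0, phi0, Real.tanh_neg]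
  ring_nf

theorem eta0_neg (x : ℝ) : eta0 (-x) = eta0 x := by
  rw [eta0, eta0, phi0_neg]
  ring

theorem phi0_node_pos : 0 < phi0 node := by
  have h := three_sub_tanh_sq node
  have : 0 < √(3 - Real.tanh node ^ 2) := Real.sqrt_pos.2 (by linarith)
  rw [phi0, tanh_node] at *
  positivity

/-- The function is the logarithmic derivative of `y ↦ p (tanh y)`, so `r' + r²` is the second
derivative of that comparison function divided by the function itself; the final square in `r'`
cancels `r²`. -/
theorem hasDerivAt_riccati {p p' : ℝ → ℝ} {c x : ℝ} {t : ℝ} (ht : t = Real.tanh x)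
    (hp : HasDerivAt p (p' t) t) (hp' : HasDerivAt p' c t) (h0 : p t ≠ 0) :
    HasDerivAt (fun y => (1 - Real.tanh y ^ 2) * p' (Real.tanh y) / p (Real.tanh y))
      ((1 - t ^ 2) * ((1 - t ^ 2) * c - 2 * t * p' t) / p t
        - ((1 - t ^ 2) * p' t / p t) ^ 2) x := by
  subst ht
  have hT := hasDerivAt_tanh x
  have h1 := ((hT.fun_pow 2).const_sub 1).fun_mul (hp'.comp x hT)
  have h2 := h1.fun_div (hp.comp x hT) h0
  convert! h2 using 1
  simp only [Function.comp]
  field_simp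
  ring

/-- Both `η₀` and the potentials of the comparison functions carry a factor `1 - tanh²`. Cancelling
it leaves a polynomial inequality in `tanh`. -/
theorem eta0_bound_of {K s A : ℝ} {x : ℝ} (hs : s = Real.tanh x ^ 2)
    (h : K * (3 * (3 + s)) ≤ A * (3 - s) ^ 2) : K * eta0 x ≤ (1 - s) * A := by
  have h3 := three_sub_tanh_sq x
  have h1 := Real.tanh_sq_lt_one x
  rw [eta0_eq, ← hs]
  rw [← hs] at h3 h1
  have : (0 : ℝ) < (3 - s) ^ 2 := by positivity
  rw [← mul_div_assoc, div_le_iff₀ this]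
  nlinarith [mul_le_mul_of_nonneg_left h (sub_nonneg.2 h1.le)]

theorem continuous_gapPotential : Continuous fun x => 6 / 5 * eta0 x :=
  continuous_eta0.const_mul _

variable {f g : ℝ → ℝ}

theorem rayleigh_middle (h : IsPrimitive f g) (hg : MemLp g 2 volume)
    (h₁ : f node = 0) (h₂ : f (-node) = 0) :
    0 ≤ ∫ x in (-node)..node, (g x ^ 2 - 6 / 5 * eta0 x * f x ^ 2) := by
  have ht : ∀ x ∈ Icc (-node) node, Real.tanh x ^ 2 ≤ 1 / 4 := by
    intro x hx
    have h1 := strictMono_tanh.monotone hx.1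
    have h2 := strictMono_tanh.monotone hx.2
    rw [Real.tanh_neg, tanh_node] at h1
    rw [tanh_node] at h2
    nlinarith
  have hc := continuous_tanh
  -- The comparison function is `1 - 2 tanh²`, positive between the nodes.
  have key := riccati_bound (a := -node) (b := node)
    (r := fun y => (1 - Real.tanh y ^ 2) * (-4 * Real.tanh y) / (1 - 2 * Real.tanh y ^ 2))
    (r' := fun y => (1 - Real.tanh y ^ 2) * ((1 - Real.tanh y ^ 2) * (-4) -
      2 * Real.tanh y * (-4 * Real.tanh y)) / (1 - 2 * Real.tanh y ^ 2) -
      ((1 - Real.tanh y ^ 2) * (-4 * Real.tanh y) / (1 - 2 * Real.tanh y ^ 2)) ^ 2)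
    (by linarith [node_pos]) h hg continuous_gapPotential ?_ ?_ ?_
  · simpa [h₁, h₂] using key
  · intro x hx
    have h3 := ht x hx
    refine hasDerivAt_riccati (p := fun t => 1 - 2 * t ^ 2) (p' := fun t => -4 * t) rfl ?_ ?_
      (by linarith)
    · have := ((hasDerivAt_pow 2 (Real.tanh x)).const_mul 2).const_sub 1
      convert! this using 1
      simp
      ring
    · simpa using (hasDerivAt_id (Real.tanh x)).const_mul (-4)
  · have h0 : ∀ x ∈ Icc (-node) node, 1 - 2 * Real.tanh x ^ 2 ≠ 0 := fun x hx => by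
      linarith [ht x hx]
    fun_prop (disch := assumption)
  · intro x hx
    have h3 := ht x hx
    have h4 : 0 < 1 - 2 * Real.tanh x ^ 2 := by linarith
    have h5 := sq_nonneg (Real.tanh x)
    have hb := eta0_bound_of (K := 6 / 5) (A := 4 * (1 - 3 * Real.tanh x ^ 2) /
      (1 - 2 * Real.tanh x ^ 2)) (x := x) rfl (by
        rw [div_mul_eq_mul_div _ (1 - 2 * Real.tanh x ^ 2), le_div_iff₀ h4]
        nlinarith [mul_nonneg h5 h5, mul_nonneg h5 (sub_nonneg.2 h3)])
    simp only [sub_add_cancel]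
    have e : (1 - Real.tanh x ^ 2) * ((1 - Real.tanh x ^ 2) * (-4) -
        2 * Real.tanh x * (-4 * Real.tanh x)) / (1 - 2 * Real.tanh x ^ 2) =
        -((1 - Real.tanh x ^ 2) * (4 * (1 - 3 * Real.tanh x ^ 2) /
          (1 - 2 * Real.tanh x ^ 2))) := by
      field_simp
      ring
    rw [e]
    linarith

theorem rayleigh_right (h : IsPrimitive f g) (hg : MemLp g 2 volume)
    (h₁ : f node = 0) {b : ℝ} (hb : node ≤ b) :
    0 ≤ ∫ x in node..b, (g x ^ 2 - 6 / 5 * eta0 x * f x ^ 2) := by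
  have ht : ∀ x ∈ Icc node b, 1 / 2 ≤ Real.tanh x := by
    intro x hx
    have h1 := strictMono_tanh.monotone hx.1
    rwa [tanh_node] at h1
  have hc := continuous_tanh
  -- The comparison function is `tanh - 12/25`. The shift must be below `1/2` for positivity from
  -- the node on, and at least `4/9` for the potential inequality as `tanh → 1`.
  have key := riccati_bound (a := node) (b := b)
    (r := fun y => (1 - Real.tanh y ^ 2) * 1 / (Real.tanh y - 12 / 25))
    (r' := fun y => (1 - Real.tanh y ^ 2) * ((1 - Real.tanh y ^ 2) * 0 -
      2 * Real.tanh y * 1) / (Real.tanh y - 12 / 25) -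
      ((1 - Real.tanh y ^ 2) * 1 / (Real.tanh y - 12 / 25)) ^ 2)
    hb h hg continuous_gapPotential ?_ ?_ ?_
  -- The boundary term at the node vanishes, and the one at `b` has the right sign because the
  -- comparison function increases.
  · refine le_trans ?_ key
    have h1 := ht b (right_mem_Icc.2 hb)
    have h2 : 0 ≤ 1 - Real.tanh b ^ 2 := by linarith [Real.tanh_sq_lt_one b]
    have h3 : 0 < Real.tanh b - 12 / 25 := by linarith
    simp only [h₁]
    norm_num
    positivity
  · intro x hx
    have h3 := ht x hx
    refine hasDerivAt_riccati (p := fun t => t - 12 / 25) (p' := fun _ => 1) rfl ?_ ?_ ?_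
    · exact (hasDerivAt_id (Real.tanh x)).sub_const _
    · exact hasDerivAt_const _ _
    · linarith
  · have h0 : ∀ x ∈ Icc node b, Real.tanh x - 12 / 25 ≠ 0 := fun x hx => by
      linarith [ht x hx]
    fun_prop (disch := assumption)
  · intro x hx
    have h3 := ht x hx
    have h4 : 0 < Real.tanh x - 12 / 25 := by linarith
    have h5 := Real.tanh_lt_one x
    have hb := eta0_bound_of (K := 6 / 5) (A := 2 * Real.tanh x / (Real.tanh x - 12 / 25))
      (x := x) rfl (by
        rw [div_mul_eq_mul_div _ (Real.tanh x - 12 / 25), le_div_iff₀ h4]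
        generalize Real.tanh x = t at *
        have k1 : 0 ≤ t * (1 - t ^ 2) := mul_nonneg (by linarith) (by nlinarith)
        have k2 : 0 ≤ t ^ 2 * (1 - t) := mul_nonneg (by positivity) (by linarith)
        have k3 : 0 ≤ (1 - t ^ 2) * (1 - t ^ 3) :=
          mul_nonneg (by nlinarith) (by nlinarith)
        have k4 : t ^ 3 ≤ 1 := by nlinarith
        nlinarith)
    simp only [sub_add_cancel]
    have e : (1 - Real.tanh x ^ 2) * ((1 - Real.tanh x ^ 2) * 0 - 2 * Real.tanh x * 1) /
        (Real.tanh x - 12 / 25) =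
        -((1 - Real.tanh x ^ 2) * (2 * Real.tanh x / (Real.tanh x - 12 / 25))) := by
      field_simp
      ring
    rw [e]
    linarith

theorem IsPrimitive.reflect (h : IsPrimitive f g) :
    IsPrimitive (fun x => f (-x)) (fun x => -g (-x)) where
  intervalIntegrable a b := by
    have := (IntervalIntegrable.iff_comp_neg (by simp)).1 (h.intervalIntegrable (-a) (-b))
    simp only [neg_neg] at this
    exact this.neg
  integral_eq_sub a b := by
    rw [intervalIntegral.integral_neg, intervalIntegral.integral_comp_neg, h.integral_eq_sub]
    ring

theorem rayleigh_left (h : IsPrimitive f g) (hg : MemLp g 2 volume)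
    (h₁ : f (-node) = 0) {b : ℝ} (hb : node ≤ b) :
    0 ≤ ∫ x in (-b)..(-node), (g x ^ 2 - 6 / 5 * eta0 x * f x ^ 2) := by
  have hg' : MemLp (fun x => -g (-x)) 2 volume :=
    (hg.comp_measurePreserving (Measure.measurePreserving_neg volume)).neg
  have key := rayleigh_right h.reflect hg' h₁ hb
  have e := intervalIntegral.integral_comp_neg (a := node) (b := b)
    fun x => g x ^ 2 - 6 / 5 * eta0 x * f x ^ 2
  rw [← e]
  simpa [eta0_neg] using key

/-- A function vanishing at `±node` has Rayleigh quotient at least `6/5`. -/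
theorem MemHReal.rayleigh_of_nodes (h : MemHReal f g) (h₁ : f node = 0) (h₂ : f (-node) = 0) :
    6 / 5 * ∫ x, eta0 x * f x ^ 2 ≤ ∫ x, g x ^ 2 := by
  have i1 := h.integrable_deriv_sq
  have i2 := h.integrable_weight_sq.const_mul (6 / 5)
  have hi : Integrable fun x => g x ^ 2 - 6 / 5 * eta0 x * f x ^ 2 := by
    simp only [mul_assoc]
    exact i1.sub i2
  have h0 : 0 ≤ ∫ x, (g x ^ 2 - 6 / 5 * eta0 x * f x ^ 2) := by
    refine ge_of_tendsto (intervalIntegral_tendsto_integral hi tendsto_neg_atTop_atBot tendsto_id) ?_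
    filter_upwards [eventually_ge_atTop node] with b hb
    have hII : ∀ c d, IntervalIntegrable (fun x => g x ^ 2 - 6 / 5 * eta0 x * f x ^ 2) volume c d :=
      fun c d => hi.intervalIntegrable
    have hl := rayleigh_left h.isPrimitive h.memLp_deriv h₂ hb
    have hm := rayleigh_middle h.isPrimitive h.memLp_deriv h₁ h₂
    have hr := rayleigh_right h.isPrimitive h.memLp_deriv h₁ hb
    rw [id, ← intervalIntegral.integral_add_adjacent_intervals (hII (-b) (-node)) (hII _ b),
      ← intervalIntegral.integral_add_adjacent_intervals (hII (-node) node) (hII _ b)]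
    linarith
  simp only [mul_assoc] at h0
  rw [integral_sub i1 i2, integral_const_mul] at h0
  linarith

/-! ### The spectral gap above the first two eigenfunctions -/

/-- Expansion of a quadratic integral, given the integrability of the three terms. -/
theorem integral_quadratic {u v w : ℝ → ℝ} (c : ℝ) (hu : Integrable u) (hv : Integrable v)
    (hw : Integrable w) : ∫ x, (u x + 2 * c * v x + c ^ 2 * w x) =
      (∫ x, u x) + 2 * c * (∫ x, v x) + c ^ 2 * ∫ x, w x := by
  have h1 : Integrable fun x => u x + 2 * c * v x := hu.add (hv.const_mul _)
  rw [integral_add h1 (hw.const_mul _), integral_add hu (hv.const_mul _), integral_const_mul,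
    integral_const_mul]

section expansions

variable {f₁ g₁ f₂ g₂ : ℝ → ℝ}

theorem MemHReal.integral_deriv_sq_add (h₁ : MemHReal f₁ g₁) (h₂ : MemHReal f₂ g₂) (c : ℝ) :
    ∫ x, (g₁ x + c * g₂ x) ^ 2 =
      (∫ x, g₁ x ^ 2) + 2 * c * (∫ x, g₂ x * g₁ x) + c ^ 2 * ∫ x, g₂ x ^ 2 := by
  rw [← integral_quadratic c h₁.integrable_deriv_sq (h₂.integrable_deriv_mul h₁)
    h₂.integrable_deriv_sq]
  congr 1
  funext x
  ring

theorem MemHReal.integral_weight_sq_add (h₁ : MemHReal f₁ g₁) (h₂ : MemHReal f₂ g₂) (c : ℝ) :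
    ∫ x, eta0 x * (f₁ x + c * f₂ x) ^ 2 = (∫ x, eta0 x * f₁ x ^ 2) +
      2 * c * (∫ x, eta0 x * (f₂ x * f₁ x)) + c ^ 2 * ∫ x, eta0 x * f₂ x ^ 2 := by
  rw [← integral_quadratic c h₁.integrable_weight_sq (h₂.integrable_weight_mul h₁)
    h₂.integrable_weight_sq]
  congr 1
  funext x
  ring

theorem MemHReal.integral_weight_add (h₁ : MemHReal f₁ g₁) (h₂ : MemHReal f₂ g₂) (c : ℝ) :
    ∫ x, eta0 x * (f₁ x + c * f₂ x) =
      (∫ x, eta0 x * f₁ x) + c * ∫ x, eta0 x * f₂ x := by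
  rw [← integral_const_mul, ← integral_add h₁.integrable_weight (h₂.integrable_weight.const_mul c)]
  congr 1
  funext x
  ring

end expansions

/-- Spectral gap: on the orthogonal complement of the first two eigenfunctions `1` and `φ₀` the
Rayleigh quotient is at least `6/5`. -/
theorem MemHReal.rayleigh_of_orthogonal (h : MemHReal f g) (h₁ : ∫ x, eta0 x * f x = 0)
    (h₂ : ∫ x, eta0 x * (phi0 x * f x) = 0) :
    6 / 5 * ∫ x, eta0 x * f x ^ 2 ≤ ∫ x, g x ^ 2 := by
  -- Since `φ₀` is odd, these coefficients make `f + b φ₀ + a` vanish at both nodes.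
  set a : ℝ := -(f node + f (-node)) / 2 with ha
  set b : ℝ := -(f node - f (-node)) / (2 * phi0 node) with hb
  have hφ := phi0_node_pos
  have hφb : b * phi0 node = -(f node - f (-node)) / 2 := by
    rw [hb]
    field_simp
  have h0 := h.add (memHReal_phi0.const_mul b)
  have hone := MemHReal.const 1
  have key := (h0.add (hone.const_mul a)).rayleigh_of_nodes (by rw [hφb, ha]; ring)
    (by rw [phi0_neg, mul_neg, hφb, ha]; ring)
  have hd := h.integral_dphi0_mul
  have hN0 : 0 ≤ ∫ x, eta0 x * phi0 x ^ 2 :=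
    integral_nonneg fun x => mul_nonneg (eta0_pos x).le (sq_nonneg _)
  have hM0 : 0 ≤ ∫ x, eta0 x := integral_nonneg fun x => (eta0_pos x).le
  rw [h0.integral_weight_sq_add hone, h0.integral_deriv_sq_add hone,
    h.integral_weight_sq_add memHReal_phi0, h.integral_deriv_sq_add memHReal_phi0] at key
  simp only [one_mul, one_pow, mul_one, zero_mul, zero_pow two_ne_zero, integral_zero, mul_zero,
    add_zero] at key
  rw [h.integral_weight_add memHReal_phi0, hd, h₁, h₂, integral_dphi0_sq,
    integral_eta0_mul_phi0] at key
  -- All cross terms are gone. The shift adds `b² ∫ η₀ φ₀²` to both quadratic forms and `a² ∫ η₀` to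
  -- the weighted one only; as `6/5 ≥ 1`, both contributions can be dropped.
  nlinarith [mul_nonneg (sq_nonneg a) hM0, mul_nonneg (sq_nonneg b) hN0]

/-! ### Local supremum bound and coercivity -/

/-- `MemHReal.abs_sub_le` for `c f` is a quadratic inequality valid for every `c`; its discriminant
is nonpositive. -/
theorem MemHReal.sq_sub_le (h : MemHReal f g) (a b : ℝ) :
    (f b - f a) ^ 2 ≤ |b - a| * ∫ x, g x ^ 2 := by
  have key : ∀ c : ℝ, 0 ≤ (∫ x, g x ^ 2) * (c * c) + (-(2 * |f b - f a|)) * c + |b - a| := by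
    intro c
    have h1 := (h.const_mul c).abs_sub_le a b
    simp only [mul_pow, integral_const_mul, ← mul_sub, abs_mul] at h1
    nlinarith [mul_le_mul_of_nonneg_right (le_abs_self c) (abs_nonneg (f b - f a))]
  have h2 := discrim_le_zero key
  rw [discrim] at h2
  nlinarith [sq_abs (f b - f a)]

theorem integral_sq_nonneg (f g : ℝ → ℝ) :
    0 ≤ ∫ x, g x ^ 2 ∧ 0 ≤ ∫ x, eta0 x * f x ^ 2 :=
  ⟨integral_nonneg fun _ => sq_nonneg _,
    integral_nonneg fun x => mul_nonneg (eta0_pos x).le (sq_nonneg _)⟩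

theorem integral_unit_le {u : ℝ → ℝ} (hu : Integrable u) (h0 : ∀ x, 0 ≤ u x) :
    ∫ x in (0 : ℝ)..1, u x ≤ ∫ x, u x := by
  rw [intervalIntegral.integral_of_le zero_le_one]
  exact setIntegral_le_integral hu (Eventually.of_forall h0)

theorem integral_unit_eta0_pos : 0 < ∫ x in (0 : ℝ)..1, eta0 x :=
  intervalIntegral.intervalIntegral_pos_of_pos (continuous_eta0.intervalIntegrable 0 1) eta0_pos
    zero_lt_one

/-- The norm of the space controls the supremum on the unit interval. -/
theorem exists_sup_bound : ∃ C : ℝ, 0 < C ∧ ∀ f g : ℝ → ℝ, MemHReal f g → ∀ x ∈ Icc (0 : ℝ) 1,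
    f x ^ 2 ≤ C * ((∫ x, g x ^ 2) + ∫ x, eta0 x * f x ^ 2) := by
  have hM := integral_unit_eta0_pos
  set M := ∫ x in (0 : ℝ)..1, eta0 x with hMdef
  refine ⟨2 / M + 2, by positivity, fun f g h x hx => ?_⟩
  obtain ⟨hA, hB⟩ := integral_sq_nonneg f g
  set A := ∫ x, g x ^ 2
  have hi : IntervalIntegrable (fun y => eta0 y * f y ^ 2) volume 0 1 :=
    h.integrable_weight_sq.intervalIntegrable
  -- Compare `f x` with `f y` through `f x² ≤ 2 f y² + 2 ∫ g²` and average over `y` in the unit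
  -- interval with weight `η₀`.
  have h1 : ∫ y in (0 : ℝ)..1, eta0 y * f x ^ 2 ≤
      ∫ y in (0 : ℝ)..1, (2 * (eta0 y * f y ^ 2) + eta0 y * (2 * A)) := by
    refine intervalIntegral.integral_mono_on zero_le_one
      ((continuous_eta0.intervalIntegrable 0 1).mul_const _)
      ((hi.const_mul 2).add ((continuous_eta0.intervalIntegrable 0 1).mul_const _)) fun y hy => ?_
    have h2 := h.sq_sub_le y x
    have h3 : |x - y| ≤ 1 := abs_le.2 ⟨by linarith [hx.1, hy.2], by linarith [hx.2, hy.1]⟩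
    have h4 : f x ^ 2 ≤ 2 * f y ^ 2 + 2 * A := by
      nlinarith [mul_le_mul_of_nonneg_right h3 hA, sq_nonneg (f x - 2 * f y)]
    nlinarith [mul_le_mul_of_nonneg_left h4 (eta0_pos y).le]
  rw [intervalIntegral.integral_mul_const, intervalIntegral.integral_add (hi.const_mul 2)
    ((continuous_eta0.intervalIntegrable 0 1).mul_const _), intervalIntegral.integral_const_mul,
    intervalIntegral.integral_mul_const, ← hMdef] at h1
  have h5 := integral_unit_le h.integrable_weight_sq
    fun y => mul_nonneg (eta0_pos y).le (sq_nonneg (f y))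
  set B := ∫ x, eta0 x * f x ^ 2
  have h6 : f x ^ 2 ≤ (2 * B + M * (2 * A)) / M := by
    rw [le_div_iff₀ hM]
    linarith
  refine h6.trans ?_
  have e : (2 / M + 2) * (A + B) - (2 * B + M * (2 * A)) / M = 2 / M * A + 2 * B := by
    field_simp
    ring
  have : 0 ≤ 2 / M * A + 2 * B := by positivity
  linarith

theorem phi0_pos {x : ℝ} (hx : 0 < x) : 0 < phi0 x := by
  have h := three_sub_tanh_sq x
  have h1 : 0 < √(3 - Real.tanh x ^ 2) := Real.sqrt_pos.2 (by linarith)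
  have h2 := strictMono_tanh hx
  rw [Real.tanh_zero] at h2
  rw [phi0]
  exact div_pos (mul_pos (by positivity) h2) h1

theorem integral_unit_eta0_mul_phi0_pow_six_pos :
    0 < ∫ x in (0 : ℝ)..1, eta0 x * phi0 x ^ 6 := by
  refine intervalIntegral.intervalIntegral_pos_of_pos_on
    ((continuous_eta0.mul (continuous_phi0.pow 6)).intervalIntegrable 0 1) (fun x hx => ?_)
    zero_lt_one
  have := phi0_pos hx.1
  have := eta0_pos x
  positivity

theorem integral_eta0_mul_phi0_sq_pos : 0 < ∫ x, eta0 x * phi0 x ^ 2 := by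
  refine lt_of_lt_of_le (intervalIntegral.intervalIntegral_pos_of_pos_on
    ((continuous_eta0.mul (continuous_phi0.pow 2)).intervalIntegrable 0 1) (fun x hx => ?_)
    zero_lt_one) (integral_unit_le memHReal_phi0.integrable_weight_sq
      fun x => mul_nonneg (eta0_pos x).le (sq_nonneg _))
  exact mul_pos (eta0_pos x) (pow_pos (phi0_pos hx.1) 2)

/-- Keep `1/12` of `∫ g²` aside; the gap applied to the rest leaves `(11/12)(6/5) - 1 = 1/10` of the
weighted term. -/
theorem MemHReal.coercive_of_orthogonal (h : MemHReal f g) (h₁ : ∫ x, eta0 x * f x = 0)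
    (h₂ : ∫ x, eta0 x * (phi0 x * f x) = 0) :
    1 / 12 * (∫ x, g x ^ 2) + 1 / 10 * (∫ x, eta0 x * f x ^ 2) ≤
      (∫ x, g x ^ 2) - ∫ x, eta0 x * f x ^ 2 := by
  have := h.rayleigh_of_orthogonal h₁ h₂
  linarith

theorem phi0_pow_four_le_one (x : ℝ) : phi0 x ^ 4 ≤ 1 := by
  have := eta0_pos x
  rw [eta0] at this
  linarith

/-- Coercivity orthogonally to the constants, with a local term controlling the direction `φ₀`. -/
theorem exists_coercive : ∃ c : ℝ, 0 < c ∧ ∀ f g : ℝ → ℝ, MemHReal f g →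
    ∫ x, eta0 x * f x = 0 →
    c * ((∫ x, g x ^ 2) + ∫ x, eta0 x * f x ^ 2) ≤ (∫ x, g x ^ 2) - (∫ x, eta0 x * f x ^ 2) +
      1 / 20 * ∫ x in (0 : ℝ)..1, eta0 x * (phi0 x ^ 4 * f x ^ 2) := by
  have hN := integral_eta0_mul_phi0_sq_pos
  have hP := integral_unit_eta0_mul_phi0_pow_six_pos
  set N := ∫ x, eta0 x * phi0 x ^ 2 with hNdef
  set P := ∫ x in (0 : ℝ)..1, eta0 x * phi0 x ^ 6 with hPdef
  refine ⟨min (1 / 20) (P / (80 * N)), by positivity, fun f g h h₁ => ?_⟩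
  set c := min (1 / 20) (P / (80 * N)) with hc
  -- Split `f = w + α φ₀` with `w` orthogonal to `1` and `φ₀`. Cross terms vanish in both forms and
  -- `φ₀` is null for `Q`, so `Q(f) = Q(w)` and only `α` remains to be controlled.
  set α : ℝ := (∫ x, eta0 x * (phi0 x * f x)) / N with hα
  have hw := h.add (memHReal_phi0.const_mul (-α))
  set w : ℝ → ℝ := fun x => f x + -α * phi0 x with hwdef
  have hw₁ : ∫ x, eta0 x * w x = 0 := by
    rw [h.integral_weight_add memHReal_phi0, h₁, integral_eta0_mul_phi0]
    ring
  have hw₂ : ∫ x, eta0 x * (phi0 x * w x) = 0 := by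
    have e : ∀ x, eta0 x * (phi0 x * w x) =
        eta0 x * (phi0 x * f x) + -α * (eta0 x * phi0 x ^ 2) := fun x => by
      simp only [hwdef]
      ring
    simp only [e]
    rw [integral_add (memHReal_phi0.integrable_weight_mul h)
      (memHReal_phi0.integrable_weight_sq.const_mul _), integral_const_mul, hα]
    field_simp
    ring
  have hcoer := hw.coercive_of_orthogonal hw₁ hw₂
  have hd := hw.integral_dphi0_mul
  rw [hw₂] at hd
  have eA := hw.integral_deriv_sq_add memHReal_phi0 α
  have eB := hw.integral_weight_sq_add memHReal_phi0 α
  rw [hd, integral_dphi0_sq] at eA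
  rw [hw₂] at eB
  have e1 : ∀ x, w x + α * phi0 x = f x := fun x => by simp only [hwdef]; ring
  have e2 : ∀ x, g x + -α * dphi0 x + α * dphi0 x = g x := fun x => by ring
  simp only [e1] at eB
  simp only [e2] at eA
  obtain ⟨hA0, hB0⟩ := integral_sq_nonneg w fun x => g x + -α * dphi0 x
  set A := ∫ x, (g x + -α * dphi0 x) ^ 2
  -- Pointwise `(w + α φ₀)² ≥ α² φ₀² / 2 - w²`, multiplied by `η₀ φ₀⁴` with `φ₀⁴ ≤ 1` in the `w²`
  -- term.
  have hloc : α ^ 2 / 2 * P - ∫ x, eta0 x * w x ^ 2 ≤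
      ∫ x in (0 : ℝ)..1, eta0 x * (phi0 x ^ 4 * f x ^ 2) := by
    have h5 := integral_unit_le hw.integrable_weight_sq
      fun y => mul_nonneg (eta0_pos y).le (sq_nonneg (w y))
    have hi6 : IntervalIntegrable (fun x => eta0 x * phi0 x ^ 6) volume 0 1 :=
      (continuous_eta0.mul (continuous_phi0.pow 6)).intervalIntegrable 0 1
    have hiw : IntervalIntegrable (fun x => eta0 x * w x ^ 2) volume 0 1 :=
      hw.integrable_weight_sq.intervalIntegrable
    have h6 : ∫ x in (0 : ℝ)..1, (α ^ 2 / 2 * (eta0 x * phi0 x ^ 6) - eta0 x * w x ^ 2) ≤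
        ∫ x in (0 : ℝ)..1, eta0 x * (phi0 x ^ 4 * f x ^ 2) := by
      refine intervalIntegral.integral_mono_on zero_le_one ((hi6.const_mul _).sub hiw)
        ((continuous_eta0.mul ((continuous_phi0.pow 4).mul
          (h.isPrimitive.continuous.pow 2))).intervalIntegrable 0 1) fun x hx => ?_
      have h7 := phi0_pow_four_le_one x
      have h8 : α ^ 2 / 2 * phi0 x ^ 6 - w x ^ 2 ≤ phi0 x ^ 4 * f x ^ 2 := by
        rw [← e1 x]
        have h9 : 0 ≤ phi0 x ^ 4 := by positivity
        nlinarith [mul_le_mul_of_nonneg_right h7 (sq_nonneg (w x)),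
          mul_nonneg h9 (sq_nonneg (2 * w x + α * phi0 x))]
      nlinarith [mul_le_mul_of_nonneg_left h8 (eta0_pos x).le]
    rw [intervalIntegral.integral_sub (hi6.const_mul _) hiw, intervalIntegral.integral_const_mul,
      ← hPdef] at h6
    linarith
  set B := ∫ x, eta0 x * w x ^ 2
  rw [eA, eB]
  have hc1 : c ≤ 1 / 20 := min_le_left _ _
  have hc2 : c * (80 * N) ≤ P := by
    rw [← le_div_iff₀ (by positivity)]
    exact min_le_right _ _
  -- The local term costs `B / 20` out of the available `B / 10` and yields `α² P / 40`, which
  -- dominates the contribution `2 c α² N` of `α φ₀` to the norm because `80 c N ≤ P`.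
  nlinarith [mul_le_mul_of_nonneg_right hc1 hA0, mul_le_mul_of_nonneg_right hc1 hB0,
    mul_le_mul_of_nonneg_left hc2 (sq_nonneg α)]

/-! ### Finiteness and exact expansion of the energy -/

theorem rho0_eq (z : ℝ → ℂ) (x : ℝ) :
    rho0 z x = 2 * (phi0 x * (z x).re) + ((z x).re ^ 2 + (z x).im ^ 2) := by
  rw [rho0, ← Complex.normSq_eq_norm_sq, Complex.normSq_apply]
  simp
  ring

theorem norm_sq_phi0_add (z : ℝ → ℂ) (x : ℝ) :
    ‖(phi0 x : ℂ) + z x‖ ^ 2 = phi0 x ^ 2 + rho0 z x := by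
  rw [rho0_eq, ← Complex.normSq_eq_norm_sq, Complex.normSq_apply]
  simp
  ring

theorem MemH.memHReal_re {z : ℝ → ℂ} (h : MemH z) :
    MemHReal (fun x => (z x).re) (fun x => (weakDeriv z x).re) where
  isPrimitive := (hasWeakDeriv_weakDeriv h.exists_hasWeakDeriv).isPrimitive_re h.continuous
  memLp_deriv := h.memLp_weakDeriv.re
  memLp_weight := by simpa using h.memLp_weight.re

theorem MemH.memHReal_im {z : ℝ → ℂ} (h : MemH z) :
    MemHReal (fun x => (z x).im) (fun x => (weakDeriv z x).im) where
  isPrimitive := (hasWeakDeriv_weakDeriv h.exists_hasWeakDeriv).isPrimitive_im h.continuous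
  memLp_deriv := h.memLp_weakDeriv.im
  memLp_weight := by simpa using h.memLp_weight.im

theorem norm_sq_eq (w : ℂ) : ‖w‖ ^ 2 = w.re ^ 2 + w.im ^ 2 := by
  rw [← Complex.normSq_eq_norm_sq, Complex.normSq_apply]
  ring

theorem MemH.normH0_sq {z : ℝ → ℂ} (h : MemH z) : normH0 z ^ 2 =
    (∫ x, (weakDeriv z x).re ^ 2) + (∫ x, (weakDeriv z x).im ^ 2) +
      (∫ x, eta0 x * (z x).re ^ 2) + ∫ x, eta0 x * (z x).im ^ 2 := by
  have h₁ := h.memHReal_re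
  have h₂ := h.memHReal_im
  have hn : 0 ≤ ∫ x, (‖weakDeriv z x‖ ^ 2 + eta0 x * ‖z x‖ ^ 2) :=
    integral_nonneg fun x => add_nonneg (sq_nonneg _) (mul_nonneg (eta0_pos x).le (sq_nonneg _))
  rw [normH0, Real.sq_sqrt hn]
  simp only [norm_sq_eq, mul_add]
  have i1 : Integrable fun x => (weakDeriv z x).re ^ 2 + (weakDeriv z x).im ^ 2 :=
    h₁.integrable_deriv_sq.add h₂.integrable_deriv_sq
  have i2 : Integrable fun x => eta0 x * (z x).re ^ 2 + eta0 x * (z x).im ^ 2 :=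
    h₁.integrable_weight_sq.add h₂.integrable_weight_sq
  rw [integral_add i1 i2, integral_add h₁.integrable_deriv_sq h₂.integrable_deriv_sq,
    integral_add h₁.integrable_weight_sq h₂.integrable_weight_sq]
  ring

theorem normL2_sq (f : ℝ → ℝ) : normL2 f ^ 2 = ∫ x, f x ^ 2 := by
  rw [normL2, Real.sq_sqrt (integral_nonneg fun x => sq_nonneg _)]

theorem energyDensity_phi0_ae : (energyDensity fun x => (phi0 x : ℂ)) =ᵐ[volume]
    fun x => dphi0 x ^ 2 + 1 / 3 * (1 - phi0 x ^ 2) ^ 2 * (2 + phi0 x ^ 2) := by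
  filter_upwards [(hasWeakDeriv_ofReal hasDerivAt_phi0 continuous_dphi0).weakDeriv_ae_eq] with x hx
  simp only [energyDensity, hx, Complex.norm_real, Real.norm_eq_abs, sq_abs]

theorem MemH.energyDensity_phi0_add_ae {z : ℝ → ℂ} (h : MemH z) :
    (energyDensity fun x => (phi0 x : ℂ) + z x) =ᵐ[volume] fun x =>
      ((dphi0 x + (weakDeriv z x).re) ^ 2 + (weakDeriv z x).im ^ 2) +
        1 / 3 * (1 - (phi0 x ^ 2 + rho0 z x)) ^ 2 * (2 + (phi0 x ^ 2 + rho0 z x)) := by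
  have hw := (hasWeakDeriv_ofReal hasDerivAt_phi0 continuous_dphi0).add
    (hasWeakDeriv_weakDeriv h.exists_hasWeakDeriv)
  filter_upwards [hw.weakDeriv_ae_eq] with x hx
  simp only [energyDensity, hx, norm_sq_phi0_add]
  rw [norm_sq_eq]
  simp

theorem integrable_energyDensity_phi0 : Integrable (energyDensity fun x => (phi0 x : ℂ)) := by
  refine Integrable.congr ?_ energyDensity_phi0_ae.symm
  refine memLp_dphi0.integrable_sq.add
    (memLp_one_sub_phi0_sq.integrable_sq.mono' ?_ (Eventually.of_forall fun x => ?_))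
  · exact (((continuous_const.mul ((continuous_const.sub (continuous_phi0.pow 2)).pow 2)).mul
      (continuous_const.add (continuous_phi0.pow 2)))).aestronglyMeasurable
  · rw [Real.norm_eq_abs, abs_of_nonneg (by positivity)]
    nlinarith [phi0_sq_lt_one x, sq_nonneg (1 - phi0 x ^ 2), mul_nonneg
      (sq_nonneg (1 - phi0 x ^ 2)) (sub_nonneg.2 (phi0_sq_lt_one x).le)]

section finiteness

variable {z : ℝ → ℂ}

theorem MemH.continuous_rho0 (h : MemH z) : Continuous (rho0 z) := by
  have h1 := h.memHReal_re.isPrimitive.continuous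
  have h2 := h.memHReal_im.isPrimitive.continuous
  have h3 := continuous_phi0
  have : rho0 z = fun x => 2 * (phi0 x * (z x).re) + ((z x).re ^ 2 + (z x).im ^ 2) := by
    funext x
    exact rho0_eq z x
  rw [this]
  fun_prop

theorem phi0_sq_add_rho0_nonneg (z : ℝ → ℂ) (x : ℝ) : 0 ≤ phi0 x ^ 2 + rho0 z x := by
  rw [← norm_sq_phi0_add]
  positivity

theorem memLp_one_sub_sq (hu : MemZ fun x => (phi0 x : ℂ) + z x) :
    MemLp (fun x => 1 - (phi0 x ^ 2 + rho0 z x) ^ 2) 2 volume := by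
  have := hu.memLp_one_sub
  have e : ∀ x, ‖(phi0 x : ℂ) + z x‖ ^ 4 = (phi0 x ^ 2 + rho0 z x) ^ 2 := fun x => by
    rw [← norm_sq_phi0_add]
    ring
  simpa only [e] using this

/-- With `S = |φ₀ + z|² ≥ 0` one has `|S - 1| ≤ |S² - 1|`, and `ρ₀ = (S - 1) + (1 - φ₀²)`. -/
theorem MemH.memLp_rho0 (h : MemH z) (hu : MemZ fun x => (phi0 x : ℂ) + z x) :
    MemLp (rho0 z) 2 volume := by
  have hc := h.continuous_rho0
  have hφ := continuous_phi0
  have h1 : MemLp (fun x => phi0 x ^ 2 + rho0 z x - 1) 2 volume := by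
    refine (memLp_one_sub_sq hu).mono (by fun_prop : Continuous _).aestronglyMeasurable
      (Eventually.of_forall fun x => ?_)
    have h2 := phi0_sq_add_rho0_nonneg z x
    rw [Real.norm_eq_abs, Real.norm_eq_abs]
    generalize phi0 x ^ 2 + rho0 z x = S at h2
    rw [← sq_le_sq]
    nlinarith [mul_nonneg h2 (sq_nonneg (S - 1)), mul_nonneg (mul_nonneg h2 h2) (sq_nonneg (S - 1))]
  refine (h1.add memLp_one_sub_phi0_sq).ae_eq (Eventually.of_forall fun x => ?_)
  simp only [Pi.add_apply]
  ring

/-- For `S ≥ 0` the potential `V(S)` is at most `(1 - S²)²`. -/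
theorem MemH.integrable_potential (h : MemH z) (hu : MemZ fun x => (phi0 x : ℂ) + z x) :
    Integrable fun x =>
      1 / 3 * (1 - (phi0 x ^ 2 + rho0 z x)) ^ 2 * (2 + (phi0 x ^ 2 + rho0 z x)) := by
  have hc := h.continuous_rho0
  have hφ := continuous_phi0
  refine (memLp_one_sub_sq hu).integrable_sq.mono'
    (by fun_prop : Continuous _).aestronglyMeasurable (Eventually.of_forall fun x => ?_)
  have h2 := phi0_sq_add_rho0_nonneg z x
  generalize phi0 x ^ 2 + rho0 z x = S at h2
  rw [Real.norm_eq_abs, abs_of_nonneg (by positivity)]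
  have e : (1 - S ^ 2) ^ 2 - 1 / 3 * (1 - S) ^ 2 * (2 + S) =
      (1 - S) ^ 2 * (1 / 3 + 5 / 3 * S + S ^ 2) := by ring
  have : 0 ≤ (1 - S) ^ 2 * (1 / 3 + 5 / 3 * S + S ^ 2) := by positivity
  linarith

theorem MemH.integrable_energyDensity (h : MemH z) (hu : MemZ fun x => (phi0 x : ℂ) + z x) :
    Integrable (energyDensity fun x => (phi0 x : ℂ) + z x) := by
  refine Integrable.congr ?_ h.energyDensity_phi0_add_ae.symm
  refine Integrable.add (Integrable.add ?_ h.memHReal_im.integrable_deriv_sq)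
    (h.integrable_potential hu)
  exact (memHReal_phi0.add h.memHReal_re).integrable_deriv_sq

theorem MemH.memLp_phi0_pow_mul_rho0 (h : MemH z) (hu : MemZ fun x => (phi0 x : ℂ) + z x) :
    MemLp (fun x => phi0 x ^ 3 * rho0 z x) 2 volume := by
  refine (h.memLp_rho0 hu).mono
    ((continuous_phi0.pow 3).mul h.continuous_rho0).aestronglyMeasurable
    (Eventually.of_forall fun x => ?_)
  rw [norm_mul]
  refine mul_le_of_le_one_left (norm_nonneg _) ?_
  rw [norm_pow]
  refine pow_le_one₀ (norm_nonneg _) ?_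
  rw [Real.norm_eq_abs, ← sq_le_one_iff_abs_le_one]
  exact (phi0_sq_lt_one x).le

theorem im_sq_le (z : ℝ → ℂ) (x : ℝ) : (z x).im ^ 2 ≤ phi0 x ^ 2 + rho0 z x := by
  rw [rho0_eq]
  nlinarith [sq_nonneg (phi0 x + (z x).re)]

/-- As `z₂² ≤ S = |φ₀ + z|²`, it suffices to integrate `S ρ₀²`. Splitting `ρ₀ = (S - 1) + (1 -
φ₀²)`, the first part is controlled by the potential, which retains the factor `S`; in the second,
`S ≤ 2 + ρ₀²` and `(1 - φ₀²)² ≤ 1`. -/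
theorem MemH.memLp_im_mul_rho0 (h : MemH z) (hu : MemZ fun x => (phi0 x : ℂ) + z x) :
    MemLp (fun x => (z x).im * rho0 z x) 2 volume := by
  have hc : Continuous fun x => (z x).im * rho0 z x :=
    h.memHReal_im.isPrimitive.continuous.mul h.continuous_rho0
  refine memLp_two_of_integrable_sq hc.aestronglyMeasurable ?_
  have i1 := (h.integrable_potential hu).const_mul 6
  have i2 := memLp_one_sub_phi0_sq.integrable_sq.const_mul 6
  have i3 := (h.memLp_rho0 hu).integrable_sq.const_mul 4
  refine ((i1.add i2).add i3).mono' (hc.pow 2).aestronglyMeasurable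
    (Eventually.of_forall fun x => ?_)
  rw [Real.norm_eq_abs, abs_of_nonneg (by positivity), mul_pow]
  refine (mul_le_mul_of_nonneg_right (im_sq_le z x) (sq_nonneg _)).trans ?_
  simp only [Pi.add_apply]
  have h2 := phi0_sq_add_rho0_nonneg z x
  have h3 := phi0_sq_lt_one x
  have h4 := sq_nonneg (phi0 x)
  generalize rho0 z x = r at *
  generalize phi0 x ^ 2 = p at *
  have h5 : (p + r) * r ^ 2 ≤ 2 * (p + r) * (1 - (p + r)) ^ 2 + 2 * (p + r) * (1 - p) ^ 2 := by
    nlinarith [mul_nonneg h2 (sq_nonneg (p + r - 1 - (1 - p)))]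
  have h6 : (p + r) * (1 - p) ^ 2 ≤ 3 * (1 - p) ^ 2 + 2 * r ^ 2 := by
    have k0 : 0 ≤ (1 - p) ^ 2 := sq_nonneg _
    have k1 : (1 - p) ^ 2 ≤ 1 := by nlinarith
    have k2 : p + r ≤ 2 + r ^ 2 := by nlinarith [sq_nonneg (r - 1 / 2)]
    nlinarith [mul_le_mul_of_nonneg_right k2 k0, mul_le_mul_of_nonneg_left k1 (sq_nonneg r)]
  nlinarith [sq_nonneg (1 - (p + r))]

/-- The part of the energy difference of order at least two in `ρ₀`. -/
noncomputable def excess (z : ℝ → ℂ) (x : ℝ) : ℝ :=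
  1 / 3 * rho0 z x ^ 2 * (2 * phi0 x ^ 2 + (phi0 x ^ 2 + rho0 z x))

/-- The identity is pointwise almost everywhere apart from the linear term `2 (φ₀' z₁' - η₀ φ₀ z₁)`,
whose integral vanishes by the soliton equation. Integrability of the excess follows since every
other term is integrable. -/
theorem MemH.energy_sub (h : MemH z) (hu : MemZ fun x => (phi0 x : ℂ) + z x) :
    Integrable (excess z) ∧
    E2 (fun x => (phi0 x : ℂ) + z x) - E2 (fun x => (phi0 x : ℂ)) =
      ((∫ x, (weakDeriv z x).re ^ 2) - ∫ x, eta0 x * (z x).re ^ 2) +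
      ((∫ x, (weakDeriv z x).im ^ 2) - ∫ x, eta0 x * (z x).im ^ 2) + ∫ x, excess z x := by
  have h₁ := h.memHReal_re
  have h₂ := h.memHReal_im
  have i0 := (h.integrable_energyDensity hu).sub integrable_energyDensity_phi0
  have j1 := memHReal_phi0.integrable_deriv_mul h₁
  have j2 := memHReal_phi0.integrable_weight_mul h₁
  have j3 := h₁.integrable_deriv_sq
  have j4 := h₁.integrable_weight_sq
  have j5 := h₂.integrable_deriv_sq
  have j6 := h₂.integrable_weight_sq
  have k1 := (j1.sub j2).const_mul 2
  have k2 := j3.sub j4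
  have k3 := j5.sub j6
  have k := (k1.add k2).add k3
  have e : (excess z) =ᵐ[volume] (fun x =>
      (energyDensity (fun x => (phi0 x : ℂ) + z x) x - energyDensity (fun x => (phi0 x : ℂ)) x)
      - (2 * (dphi0 x * (weakDeriv z x).re - eta0 x * (phi0 x * (z x).re)) +
      ((weakDeriv z x).re ^ 2 - eta0 x * (z x).re ^ 2) +
      ((weakDeriv z x).im ^ 2 - eta0 x * (z x).im ^ 2))) := by
    filter_upwards [h.energyDensity_phi0_add_ae, energyDensity_phi0_ae] with x h1 h2
    rw [h1, h2, excess, rho0_eq, eta0]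
    ring
  refine ⟨(i0.sub k).congr e.symm, ?_⟩
  have e2 : ∫ x, excess z x = (∫ x, (energyDensity (fun x => (phi0 x : ℂ) + z x) x -
      energyDensity (fun x => (phi0 x : ℂ)) x)) - ∫ x, (2 * (dphi0 x * (weakDeriv z x).re -
      eta0 x * (phi0 x * (z x).re)) + ((weakDeriv z x).re ^ 2 - eta0 x * (z x).re ^ 2) +
      ((weakDeriv z x).im ^ 2 - eta0 x * (z x).im ^ 2)) := by
    rw [integral_congr_ae e]
    exact integral_sub i0 k
  have e3 : ∫ x, (2 * (dphi0 x * (weakDeriv z x).re -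
      eta0 x * (phi0 x * (z x).re)) + ((weakDeriv z x).re ^ 2 - eta0 x * (z x).re ^ 2) +
      ((weakDeriv z x).im ^ 2 - eta0 x * (z x).im ^ 2)) =
      (2 * ((∫ x, dphi0 x * (weakDeriv z x).re) - ∫ x, eta0 x * (phi0 x * (z x).re)) +
      ((∫ x, (weakDeriv z x).re ^ 2) - ∫ x, eta0 x * (z x).re ^ 2)) +
      ((∫ x, (weakDeriv z x).im ^ 2) - ∫ x, eta0 x * (z x).im ^ 2) := by
    rw [← integral_sub j1 j2, ← integral_sub j3 j4, ← integral_sub j5 j6, ← integral_const_mul]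
    exact (integral_add (k1.add k2) k3).trans (congrArg (· + _) (integral_add k1 k2))
  rw [e2, e3, h₁.integral_dphi0_mul, integral_sub (h.integrable_energyDensity hu)
    integrable_energyDensity_phi0, E2, E2]
  ring

/-! ### Lower bound for the excess -/

/-- Lower bound for the part of the energy difference of higher order. -/
theorem MemH.le_integral_excess (h : MemH z) (hu : MemZ fun x => (phi0 x : ℂ) + z x) {m : ℝ}
    (hm : ∀ x ∈ Icc (0 : ℝ) 1, |(z x).re| ≤ m) :
    1 / 3 * (∫ x, (phi0 x ^ 3 * rho0 z x) ^ 2) + 1 / 3 * (∫ x, ((z x).im * rho0 z x) ^ 2) +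
      1 / 20 * (∫ x in (0 : ℝ)..1, eta0 x * (phi0 x ^ 4 * (z x).re ^ 2)) -
      m / 20 * ((∫ x, eta0 x * (z x).re ^ 2) + ∫ x, eta0 x * (z x).im ^ 2) ≤
      ∫ x, excess z x := by
  have h₁ := h.memHReal_re
  have h₂ := h.memHReal_im
  have c1 := h₁.isPrimitive.continuous
  have c2 := h₂.isPrimitive.continuous
  have hm0 : 0 ≤ m := (abs_nonneg _).trans (hm 0 (by simp))
  have iP := (h.memLp_phi0_pow_mul_rho0 hu).integrable_sq.const_mul (1 / 3)
  have iS := (h.memLp_im_mul_rho0 hu).integrable_sq.const_mul (1 / 3)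
  have iT : Integrable fun x => 1 / 3 * (phi0 x * rho0 z x) ^ 2 := by
    refine Integrable.const_mul ((h.memLp_rho0 hu).integrable_sq.mono'
      ((continuous_phi0.mul h.continuous_rho0).pow 2).aestronglyMeasurable
      (Eventually.of_forall fun x => ?_)) _
    rw [Real.norm_eq_abs, abs_of_nonneg (sq_nonneg _), mul_pow]
    exact mul_le_of_le_one_left (sq_nonneg _) (phi0_sq_lt_one x).le
  -- Use `|φ₀ + z|² ≥ z₂²` for one norm, and divide `2 φ₀²` into `φ₀⁶ ≤ φ₀²` for the other and a
  -- spare `φ₀²` for the local term.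
  have hsplit : (∫ x, 1 / 3 * (phi0 x ^ 3 * rho0 z x) ^ 2) +
      (∫ x, 1 / 3 * ((z x).im * rho0 z x) ^ 2) + (∫ x, 1 / 3 * (phi0 x * rho0 z x) ^ 2) ≤
      ∫ x, excess z x := by
    have iPS : Integrable fun x =>
        1 / 3 * (phi0 x ^ 3 * rho0 z x) ^ 2 + 1 / 3 * ((z x).im * rho0 z x) ^ 2 := iP.add iS
    rw [← integral_add iP iS, ← integral_add iPS iT]
    refine integral_mono (iPS.add iT) (h.energy_sub hu).1 fun x => ?_
    have h3 := im_sq_le z x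
    have h4 := phi0_pow_four_le_one x
    have h5 : phi0 x ^ 6 ≤ phi0 x ^ 2 := by nlinarith [sq_nonneg (phi0 x)]
    simp only [excess]
    nlinarith [mul_le_mul_of_nonneg_right h3 (sq_nonneg (rho0 z x)),
      mul_le_mul_of_nonneg_right h5 (sq_nonneg (rho0 z x))]
  have hunit := integral_unit_le iT fun x => mul_nonneg (by norm_num) (sq_nonneg _)
  have j1 : IntervalIntegrable (fun x => eta0 x * (phi0 x ^ 4 * (z x).re ^ 2)) volume 0 1 :=
    (continuous_eta0.mul ((continuous_phi0.pow 4).mul (c1.pow 2))).intervalIntegrable 0 1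
  have j2 : IntervalIntegrable (fun x => eta0 x * (z x).re ^ 2) volume 0 1 :=
    h₁.integrable_weight_sq.intervalIntegrable
  have j3 : IntervalIntegrable (fun x => eta0 x * (z x).im ^ 2) volume 0 1 :=
    h₂.integrable_weight_sq.intervalIntegrable
  have hloc : ∫ x in (0 : ℝ)..1, (1 / 20 * (eta0 x * (phi0 x ^ 4 * (z x).re ^ 2)) -
      m / 20 * (eta0 x * (z x).re ^ 2 + eta0 x * (z x).im ^ 2)) ≤
      ∫ x in (0 : ℝ)..1, 1 / 3 * (phi0 x * rho0 z x) ^ 2 := by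
    refine intervalIntegral.integral_mono_on zero_le_one
      ((j1.const_mul _).sub ((j2.add j3).const_mul _)) iT.intervalIntegrable fun x hx => ?_
    have k1 := eta0_pos x
    have k2 := eta0_le_one x
    have k3 := hm x hx
    have k4 := phi0_sq_lt_one x
    have k5 : |phi0 x ^ 3| ≤ 1 := by
      rw [abs_pow]
      exact pow_le_one₀ (abs_nonneg _) ((sq_le_one_iff_abs_le_one _).1 k4.le)
    have k6 : |phi0 x ^ 3 * (z x).re| ≤ m := by
      rw [abs_mul]
      exact (mul_le_of_le_one_left (abs_nonneg _) k5).trans k3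
    have k7 := neg_le_of_abs_le k6
    -- Expand `φ₀ ρ₀ = 2 φ₀² z₁ + φ₀ |z|²`: the cross term `4 φ₀³ z₁ |z|²` is at least `-4 m |z|²`,
    -- and the quartic term is nonnegative.
    have k8 : 4 * (phi0 x ^ 4 * (z x).re ^ 2) - 4 * m * ((z x).re ^ 2 + (z x).im ^ 2) ≤
        (phi0 x * rho0 z x) ^ 2 := by
      rw [rho0_eq]
      have k9 : 0 ≤ (z x).re ^ 2 + (z x).im ^ 2 := by positivity
      nlinarith [mul_le_mul_of_nonneg_right k7 k9,
        sq_nonneg (phi0 x * ((z x).re ^ 2 + (z x).im ^ 2))]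
    have k10 := mul_le_mul_of_nonneg_left k8 k1.le
    have k11 := mul_le_mul_of_nonneg_right k2 (sq_nonneg (phi0 x * rho0 z x))
    -- Multiplying by `1/80` produces the factors `1/20` and `m/20`, and `1/80 ≤ 1/3`.
    nlinarith [sq_nonneg (phi0 x * rho0 z x)]
  rw [intervalIntegral.integral_sub (j1.const_mul _) ((j2.add j3).const_mul _),
    intervalIntegral.integral_const_mul, intervalIntegral.integral_const_mul,
    intervalIntegral.integral_add j2 j3] at hloc
  have l2 := integral_unit_le h₁.integrable_weight_sq
    fun x => mul_nonneg (eta0_pos x).le (sq_nonneg _)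
  have l3 := integral_unit_le h₂.integrable_weight_sq
    fun x => mul_nonneg (eta0_pos x).le (sq_nonneg _)
  rw [integral_const_mul, integral_const_mul] at hsplit
  have l4 := mul_le_mul_of_nonneg_left (add_le_add l2 l3) (show 0 ≤ m / 20 by positivity)
  linarith

end finiteness

/-! ### Orthogonality conditions and the final estimate -/

theorem pairing_eta0 (z : ℝ → ℂ) (x : ℝ) : pairing (eta0 x : ℂ) (z x) = eta0 x * (z x).re := by
  simp [pairing]

theorem pairing_I_mul_eta0 (z : ℝ → ℂ) (x : ℝ) :
    pairing (Complex.I * (eta0 x : ℂ)) (z x) = eta0 x * (z x).im := by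
  simp [pairing]

theorem pairing_I_mul_phi0_mul_eta0 (z : ℝ → ℂ) (x : ℝ) :
    pairing (Complex.I * (phi0 x : ℂ) * (eta0 x : ℂ)) (z x) = eta0 x * (phi0 x * (z x).im) := by
  simp [pairing]
  ring

theorem exists_energy_coercivity : ∃ Λ : ℝ, 0 < Λ ∧ ∀ z : ℝ → ℂ, MemH z →
    MemZ (fun x => (phi0 x : ℂ) + z x) → ∫ x, eta0 x * (z x).re = 0 →
    ∫ x, eta0 x * (z x).im = 0 → ∫ x, eta0 x * (phi0 x * (z x).im) = 0 →
    Λ * (normH0 z ^ 2 + normL2 (fun x => phi0 x ^ 3 * rho0 z x) ^ 2 +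
        normL2 (fun x => (z x).im * rho0 z x) ^ 2) - 1 / Λ * normH0 z ^ 3 ≤
      E2 (fun x => (phi0 x : ℂ) + z x) - E2 (fun x => (phi0 x : ℂ)) := by
  obtain ⟨c, hc, hcoer⟩ := exists_coercive
  obtain ⟨C, hC, hsup⟩ := exists_sup_bound
  -- The entry `c` serves `z₁`; `1/12` serves `z₂` and, being below `1/3`, the `ρ₀` norms; the last
  -- entry ensures `√C / 20 ≤ 1 / Λ`, which absorbs the cubic error.
  refine ⟨min (min c (1 / 12)) (1 / (√C / 20 + 1)), by positivity, fun z h hu o₁ o₂ o₃ => ?_⟩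
  set Λ := min (min c (1 / 12)) (1 / (√C / 20 + 1))
  have hΛ : 0 < Λ := by positivity
  have hΛ₁ : Λ ≤ c := (min_le_left _ _).trans (min_le_left _ _)
  have hΛ₂ : Λ ≤ 1 / 12 := (min_le_left _ _).trans (min_le_right _ _)
  have hΛ₃ : √C / 20 ≤ 1 / Λ := by
    have h1 : Λ ≤ 1 / (√C / 20 + 1) := min_le_right _ _
    have h2 := (le_one_div hΛ (by positivity)).1 h1
    linarith
  have h₁ := h.memHReal_re
  have h₂ := h.memHReal_im
  have key₁ := hcoer _ _ h₁ o₁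
  have key₂ := h₂.coercive_of_orthogonal o₂ o₃
  obtain ⟨hA₁, hB₁⟩ := integral_sq_nonneg (fun x => (z x).re) fun x => (weakDeriv z x).re
  obtain ⟨hA₂, hB₂⟩ := integral_sq_nonneg (fun x => (z x).im) fun x => (weakDeriv z x).im
  have hn : 0 ≤ normH0 z := Real.sqrt_nonneg _
  have hn2 := h.normH0_sq
  have hm : ∀ x ∈ Icc (0 : ℝ) 1, |(z x).re| ≤ √C * normH0 z := by
    intro x hx
    refine abs_le_of_sq_le_sq ?_ (by positivity)
    rw [mul_pow, Real.sq_sqrt hC.le, hn2]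
    exact (hsup _ _ h₁ x hx).trans (mul_le_mul_of_nonneg_left (by linarith) hC.le)
  have key₃ := h.le_integral_excess hu hm
  rw [(h.energy_sub hu).2, normL2_sq, normL2_sq]
  have hP : 0 ≤ ∫ x, (phi0 x ^ 3 * rho0 z x) ^ 2 := integral_nonneg fun x => sq_nonneg _
  have hS : 0 ≤ ∫ x, ((z x).im * rho0 z x) ^ 2 := integral_nonneg fun x => sq_nonneg _
  have hcube : √C * normH0 z / 20 * ((∫ x, eta0 x * (z x).re ^ 2) + ∫ x, eta0 x * (z x).im ^ 2) ≤
      1 / Λ * normH0 z ^ 3 := by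
    calc _ ≤ √C * normH0 z / 20 * normH0 z ^ 2 := by
          refine mul_le_mul_of_nonneg_left ?_ (by positivity)
          linarith
      _ = √C / 20 * normH0 z ^ 3 := by ring
      _ ≤ 1 / Λ * normH0 z ^ 3 := mul_le_mul_of_nonneg_right hΛ₃ (by positivity)
  rw [hn2]
  have m₁ := mul_le_mul_of_nonneg_right hΛ₁ (add_nonneg hA₁ hB₁)
  have m₂ := mul_le_mul_of_nonneg_right hΛ₂ (add_nonneg hA₂ hB₂)
  have m₃ := mul_le_mul_of_nonneg_right hΛ₂ (add_nonneg hP hS)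
  linarith

end QuinticGP

theorem proposition3p2 :
    ∃ Λ₀ : ℝ, 0 < Λ₀ ∧
      ∀ z : ℝ → ℂ, QuinticGP.MemH z →
        QuinticGP.MemZ (fun x => (QuinticGP.phi0 x : ℂ) + z x) →
        (∫ x, QuinticGP.pairing (QuinticGP.eta0 x : ℂ) (z x)) = 0 →
        (∫ x, QuinticGP.pairing (Complex.I * (QuinticGP.eta0 x : ℂ)) (z x)) = 0 →
        (∫ x, QuinticGP.pairing
          (Complex.I * (QuinticGP.phi0 x : ℂ) * (QuinticGP.eta0 x : ℂ)) (z x)) = 0 →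
        -- all the quantities in the estimate are finite
        MeasureTheory.Integrable (QuinticGP.energyDensity fun x => (QuinticGP.phi0 x : ℂ))
          MeasureTheory.volume ∧
        MeasureTheory.Integrable
          (QuinticGP.energyDensity fun x => (QuinticGP.phi0 x : ℂ) + z x)
          MeasureTheory.volume ∧
        MeasureTheory.MemLp (fun x => QuinticGP.phi0 x ^ 3 * QuinticGP.rho0 z x) 2
          MeasureTheory.volume ∧
        MeasureTheory.MemLp (fun x => (z x).im * QuinticGP.rho0 z x) 2
          MeasureTheory.volume ∧
        -- the coercivity estimate
        QuinticGP.E2 (fun x => (QuinticGP.phi0 x : ℂ) + z x)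
            - QuinticGP.E2 (fun x => (QuinticGP.phi0 x : ℂ)) ≥
          Λ₀ * (QuinticGP.normH0 z ^ 2
              + QuinticGP.normL2 (fun x => QuinticGP.phi0 x ^ 3 * QuinticGP.rho0 z x) ^ 2
              + QuinticGP.normL2 (fun x => (z x).im * QuinticGP.rho0 z x) ^ 2)
            - 1 / Λ₀ * QuinticGP.normH0 z ^ 3 := by
  obtain ⟨Λ, hΛ, H⟩ := QuinticGP.exists_energy_coercivity
  refine ⟨Λ, hΛ, fun z h hu o₁ o₂ o₃ => ⟨QuinticGP.integrable_energyDensity_phi0,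
    h.integrable_energyDensity hu, h.memLp_phi0_pow_mul_rho0 hu, h.memLp_im_mul_rho0 hu, ?_⟩⟩
  simp only [QuinticGP.pairing_eta0] at o₁
  simp only [QuinticGP.pairing_I_mul_eta0] at o₂
  simp only [QuinticGP.pairing_I_mul_phi0_mul_eta0] at o₃
  exact H z h hu o₁ o₂ o₃
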